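/- Let $r\ge 0$, let $|\cdot|$ be any norm on $\mathbb R^d$, and let $\mathcal C=C([-r,0],\mathbb R^d)$ carry the supremum norm. For a function $x$ that is defined and continuous on $[t-r,t]$, let $x_t\in\mathcal C$ be given by $x_t(\theta)=x(t+\theta)$, $\theta\in[-r,0]$. Let $f:\mathbb R_+\times\mathcal C\to\mathbb R^d$ be continuous and satisfy (H5) $f$ is bounded on bounded subsets of $\mathbb R_+\times\mathcal C$. Suppose that one of the following holds: (a) $f$ is periodic in $t$, i.e. for some $T>0$, $f(t+T,x)=f(t,x)$ for all $t\ge0$, $x\in\mathcal C$, or more generally $f$ is a finite sum of continuous functions $\mathbb R_+\times\mathcal C\to\mathbb R^d$ each of which is periodic in $t$ (with possibly different periods); (b) $f$ is almost periodic in $t$, i.e. for every $x\in\mathcal C$ and $\eta>0$ there is $\ell>0$ such that every interval $[a,a+\ell]$, $a\ge0$, contains a $\tau$ with $|f(t+\tau,x)-f(t,x)|<\eta$ for all $t\ge0$; and (H1) $f$ is continuous in the second variable uniformly with respect to the first: for every $x\in\mathcal C$ and $\eta>0$ there is $\rho>0$ such that $\|x'-x\|<\rho$ implies $|f(t,x')-f(t,x)|<\eta$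 for all $t\ge0$. Then the average $$F(x)=\lim_{T\to\infty}\frac1T\int_0^T f(t,x)\,dt$$ exists for every $x\in\mathcal C$, and the following holds for every $\phi\in\mathcal C$ such that (H6) the initial value problem $\dot y(t)=F(y_t)$, $y_0=\phi$, has a unique solution (a maximal solution exists, and any two solutions agree wherever both are defined). Let $y$ be the maximal solution of this problem, $J$ its interval of definition, and let $L\in J$, $L>0$. Then for every $\delta>0$ there is $\varepsilon_0=\varepsilon_0(L,\delta)>0$ such that, for all $\varepsilon\in(0,\varepsilon_0]$, every maximal solution $x$ of $$\dot x(t)=f(t/\varepsilon,x_t),\qquad x_0=\phi,$$ is defined at least on $[-r,L]$ and satisfies $|x(t)-y(t)|<\delta$ for all $t\in[0,L]$. Here a solution is a continuous function on an interval with least element $-r$ that contains $[-r,0]$ and some positive time; it equals $\phi$ on $[-r,0]$ and satisfies the equation at all $t\ge0$ of the interval (with one-sided derivatives at $t=0$ and at the right end point if that belongs to the interval). It is maximal if no solution properly extends it. -/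

import Mathlib

open Filter Topology Bornology

namespace RFDE

/-- The Banach space `𝒞 = C([-r, 0], E)` of continuous histories, with the supremum norm. -/
abbrev Hist (r : ℝ) (E : Type*) [NormedAddCommGroup E] : Type _ :=
  C(Set.Icc (-r) (0 : ℝ), E)

section VectorFields

variable {r : ℝ} {E : Type*} [NormedAddCommGroup E]

/-! A vector field `f : ℝ₊ × 𝒞 → E` is represented by a function `f : ℝ → Hist r E → E`, of which
only the values at times `t ≥ 0` are ever used. -/

/-- Joint continuity of `f` on `ℝ₊ × 𝒞`. -/
def IsContinuousField (f : ℝ → Hist r E → E) : Prop :=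
  ContinuousOn (Function.uncurry f) (Set.Ici (0 : ℝ) ×ˢ (Set.univ : Set (Hist r E)))

/-- `f` is continuous in the second variable, uniformly with respect to the first one. -/
def UniformlyContinuousInState (f : ℝ → Hist r E → E) : Prop :=
  ∀ x : Hist r E, ∀ η > (0 : ℝ), ∃ ρ > (0 : ℝ), ∀ x' : Hist r E, ‖x' - x‖ < ρ →
    ∀ t : ℝ, 0 ≤ t → ‖f t x' - f t x‖ < η

/-- `f` is quasi-bounded: bounded on bounded subsets of `ℝ₊ × 𝒞`. -/
def QuasiBounded (f : ℝ → Hist r E → E) : Prop :=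
  ∀ B : Set (ℝ × Hist r E), B ⊆ Set.Ici (0 : ℝ) ×ˢ Set.univ → IsBounded B →
    IsBounded (Function.uncurry f '' B)

/-- `f` is periodic in the first variable. -/
def PeriodicInTime (f : ℝ → Hist r E → E) : Prop :=
  ∃ T : ℝ, 0 < T ∧ ∀ t : ℝ, 0 ≤ t → ∀ x : Hist r E, f (t + T) x = f t x

/-- `f` is a finite sum of continuous functions on `ℝ₊ × 𝒞`, each periodic in the first variable
(the periods may differ). -/
def SumOfPeriodicInTime (f : ℝ → Hist r E → E) : Prop :=
  ∃ (n : ℕ) (p : Fin n → ℝ → Hist r E → E),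
    (∀ i, IsContinuousField (p i) ∧ PeriodicInTime (p i)) ∧
    ∀ t : ℝ, 0 ≤ t → ∀ x : Hist r E, f t x = ∑ i, p i t x

/-- `f` is (Bohr) almost periodic in the first variable: for every fixed `x`, the function
`t ↦ f t x` on `ℝ₊` has, for every `η > 0`, a relatively dense set of `η`-almost periods. -/
def AlmostPeriodicInTime (f : ℝ → Hist r E → E) : Prop :=
  ∀ x : Hist r E, ∀ η > (0 : ℝ), ∃ ℓ > (0 : ℝ), ∀ a : ℝ, 0 ≤ a → ∃ τ ∈ Set.Icc a (a + ℓ),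
    ∀ t : ℝ, 0 ≤ t → ‖f (t + τ) x - f t x‖ < η

variable [NormedSpace ℝ E]

/-- `F` is the time average of `f`: for every `x`, the limit of `(1/T) ∫₀ᵀ f(t, x) dt` as
`T → ∞` exists and equals `F x`. -/
def IsTimeAverage (f : ℝ → Hist r E → E) (F : Hist r E → E) : Prop :=
  ∀ x : Hist r E, Tendsto (fun T : ℝ => (1 / T) • ∫ t in (0 : ℝ)..T, f t x) atTop (𝓝 (F x))

/-- `x : I → E` is a solution of the initial value problem `x'(t) = g(t, x_t)`, `x_0 = φ`.
Here `I` is an interval with least element `-r` that contains `[-r, 0]` and some positive time, and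
`x_t ∈ 𝒞` is the history `x_t(θ) = x(t + θ)`, `θ ∈ [-r, 0]`. At `t = 0` (and at the right end
point of `I`, if it belongs to `I`) the derivative is one-sided. Values of `x` off `I` play no
role. -/
structure IsSolution (g : ℝ → Hist r E → E) (φ : Hist r E) (I : Set ℝ) (x : ℝ → E) : Prop where
  ordConnected : I.OrdConnected
  subset_Ici : I ⊆ Set.Ici (-r)
  Icc_subset : Set.Icc (-r) 0 ⊆ I
  exists_pos : ∃ t ∈ I, 0 < t
  continuousOn : ContinuousOn x I
  initial : ∀ θ : Set.Icc (-r) (0 : ℝ), x θ = φ θ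
  equation : ∀ t ∈ I, 0 ≤ t → ∃ xt : Hist r E, (∀ θ : Set.Icc (-r) (0 : ℝ), xt θ = x (t + θ)) ∧
    HasDerivWithinAt x (g t xt) (I ∩ Set.Ici 0) t

/-- A maximal (noncontinuable) solution: no solution properly extends it. -/
def IsMaximalSolution (g : ℝ → Hist r E → E) (φ : Hist r E) (I : Set ℝ) (x : ℝ → E) : Prop :=
  IsSolution g φ I x ∧
    ∀ (I' : Set ℝ) (x' : ℝ → E), IsSolution g φ I' x' → I ⊆ I' → Set.EqOn x' x I → I' = I

/-- The initial value problem `x'(t) = g(t, x_t)`, `x_0 = φ` has a unique solution: a maximal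
solution exists, and any two solutions agree wherever both are defined. -/
def HasUniqueSolution (g : ℝ → Hist r E → E) (φ : Hist r E) : Prop :=
  (∃ (I : Set ℝ) (x : ℝ → E), IsMaximalSolution g φ I x) ∧
    ∀ (I₁ I₂ : Set ℝ) (x₁ x₂ : ℝ → E), IsSolution g φ I₁ x₁ → IsSolution g φ I₂ x₂ →
      Set.EqOn x₁ x₂ (I₁ ∩ I₂)

end VectorFields

end RFDE

/-! The proof is by compactness. On `[0, L]` the histories of `y` form a compact set; near it `f` is
bounded by some `M` for all times simultaneously (`BoundedInTime.exists_bound_near_compact`), so the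
bound survives the substitution `t / ε`. A solution `x` is therefore `M`-Lipschitz while it stays
close to `y`, with `M` independent of `ε`. Being maximal, it cannot end before `L` while it stays
close: if the claim fails, it reaches a fixed distance `d > 0` from `y` at some time `b ≤ L`
(`IsMaximalSolution.exists_exit_time`).

If this happens for a sequence `ε → 0`, Arzelà–Ascoli gives a limit path `u` and a limit exit time
`c`. The integrals of `f (s / ε)` along the converging paths tend to the integral of `F` along `u`
(`IsTimeAverage.tendsto_integral_hist`), so `u` solves the averaged problem on `[-r, c]`. By
uniqueness `u c = y c`, although their distance is `d`.

The average exists because the primitive of an almost periodic function is additive up to an error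
`C + η * T` (`exists_tendsto_of_almost_additive`). For sums of periodic fields, the average, the
uniform continuity and the boundedness are obtained for each summand and added. -/

namespace RFDE

open scoped NNReal

/-! ### Mean values of almost periodic functions. -/

section Averages

variable {E : Type*} [NormedAddCommGroup E]

/-- A function on `ℝ₊` is (Bohr) almost periodic. -/
def IsAlmostPeriodic (g : ℝ → E) : Prop :=
  ∀ η > (0 : ℝ), ∃ ℓ > (0 : ℝ), ∀ a : ℝ, 0 ≤ a → ∃ τ ∈ Set.Icc a (a + ℓ),
    ∀ t : ℝ, 0 ≤ t → ‖g (t + τ) - g t‖ < η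

/-- An almost period in `[t - ℓ, t]` carries a late time `t` back to the compact interval `[0, ℓ]`
at the cost of an error `1`. -/
theorem IsAlmostPeriodic.exists_bound {g : ℝ → E} (hg : ContinuousOn g (Set.Ici 0))
    (hap : IsAlmostPeriodic g) : ∃ M, ∀ t, 0 ≤ t → ‖g t‖ ≤ M := by
  obtain ⟨ℓ, hℓ, h⟩ := hap 1 one_pos
  obtain ⟨M, hM⟩ := (isCompact_Icc (a := (0 : ℝ)) (b := ℓ)).exists_bound_of_continuousOn
    (hg.mono fun t ht => ht.1)
  refine ⟨M + 1, fun t ht => ?_⟩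
  rcases le_total t ℓ with hle | hle
  · linarith [hM t ⟨ht, hle⟩]
  · obtain ⟨τ, hτ, hτ'⟩ := h (t - ℓ) (by linarith)
    have h1 := hτ' (t - τ) (by linarith [hτ.2])
    have h2 := hM (t - τ) ⟨by linarith [hτ.2], by linarith [hτ.1]⟩
    rw [sub_add_cancel] at h1
    have := norm_add_le (g t - g (t - τ)) (g (t - τ))
    rw [sub_add_cancel] at this
    linarith

theorem _root_.ContinuousOn.intervalIntegrable_of_Ici {g : ℝ → E}
    (hg : ContinuousOn g (Set.Ici 0)) {a b : ℝ}
    (ha : 0 ≤ a) (hb : 0 ≤ b) : IntervalIntegrable g MeasureTheory.volume a b :=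
  (hg.mono fun _ ht => (le_min ha hb).trans ht.1).intervalIntegrable

variable [NormedSpace ℝ E]

/-- A Lipschitz function `Φ` on `ℝ₊` which is additive up to an error of small linear growth has
a mean slope. -/
theorem exists_tendsto_of_almost_additive [CompleteSpace E] {Φ : ℝ → E} {M : ℝ} (h0 : Φ 0 = 0)
    (hM : ∀ s t, 0 ≤ s → s ≤ t → ‖Φ t - Φ s‖ ≤ M * (t - s))
    (h : ∀ η > (0 : ℝ), ∃ C, 0 ≤ C ∧ ∀ a T, 0 ≤ a → 0 ≤ T →
      ‖Φ (a + T) - Φ a - Φ T‖ ≤ C + η * T) :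
    ∃ A, Tendsto (fun T : ℝ => (1 / T) • Φ T) atTop (𝓝 A) := by
  have hM0 : 0 ≤ M := by
    have := (norm_nonneg _).trans (hM 0 1 le_rfl zero_le_one)
    simpa using this
  have key : ∀ η > (0 : ℝ), ∃ S₀ : ℝ, ∃ c : E, ∀ S ≥ S₀, ‖(1 / S) • Φ S - c‖ ≤ 3 * η := by
    intro η hη
    obtain ⟨C, hC, hadd⟩ := h η hη
    -- With `C ≤ η * T`, each block of length `T` contributes an error of at most `2 * η * T`.
    set T : ℝ := C / η + 1 with hTdef
    have hT : 0 < T := by positivity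
    have hCT : C ≤ η * T := by
      rw [hTdef, mul_add, mul_div_cancel₀ _ hη.ne']; linarith
    -- For such `S`, the two boundary terms of size `M * T` (incomplete last block, fractional
    -- multiple of `Φ T`) together cost at most `η * S`.
    refine ⟨2 * M * T / η + 1, (1 / T) • Φ T, fun S hS => ?_⟩
    have hS0 : 0 < S := lt_of_lt_of_le (by positivity) hS
    have hMS : 2 * M * T ≤ η * S := by
      have : 2 * M * T / η ≤ S := by linarith
      rw [div_le_iff₀ hη] at this; linarith
    have hmul : ∀ n : ℕ, ‖Φ (n * T) - (n : ℝ) • Φ T‖ ≤ n * (C + η * T) := by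
      intro n
      induction n with
      | zero => simp [h0]
      | succ n ih =>
        have h1 := hadd (n * T) T (by positivity) hT.le
        have e : Φ ((n + 1 : ℕ) * T) - ((n + 1 : ℕ) : ℝ) • Φ T =
            (Φ (n * T + T) - Φ (n * T) - Φ T) + (Φ (n * T) - (n : ℝ) • Φ T) := by
          push_cast
          rw [add_mul, one_mul, add_smul, one_smul]; abel
        rw [e]
        refine (norm_add_le _ _).trans ?_
        push_cast
        linarith
    set n := ⌊S / T⌋₊ with hn
    have hnle : (n : ℝ) * T ≤ S := by
      rw [← le_div_iff₀ hT]; exact Nat.floor_le (by positivity)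
    have hlt : S < (n + 1) * T := by
      rw [← div_lt_iff₀ hT]; exact Nat.lt_floor_add_one _
    have b1 := hM (n * T) S (by positivity) hnle
    have b2 := hmul n
    have b3 : ‖((S - n * T) / T) • Φ T‖ ≤ M * T := by
      rw [norm_smul, Real.norm_of_nonneg (div_nonneg (by linarith) hT.le)]
      have h1 : ‖Φ T‖ ≤ M * T := by simpa [h0] using hM 0 T le_rfl hT.le
      have h2 : (S - n * T) / T ≤ 1 := by rw [div_le_one hT]; linarith
      nlinarith [norm_nonneg (Φ T)]
    have e : (1 / S) • Φ S - (1 / T) • Φ T = (1 / S) • ((Φ S - Φ (n * T)) +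
        (Φ (n * T) - (n : ℝ) • Φ T) - ((S - n * T) / T) • Φ T) := by
      have : (1 / T) • Φ T = (1 / S) • (((n : ℝ) + (S - n * T) / T) • Φ T) := by
        rw [smul_smul]; congr 1; field_simp; ring
      rw [this, add_smul, ← smul_sub]; congr 1; abel
    rw [e, norm_smul, Real.norm_of_nonneg (by positivity), one_div, inv_mul_le_iff₀ hS0]
    refine (norm_sub_le _ _).trans ((add_le_add_left (norm_add_le _ _) _).trans ?_)
    have b4 : (n : ℝ) * (C + η * T) ≤ 2 * η * S := by
      calc (n : ℝ) * (C + η * T) ≤ n * (2 * η * T) := by gcongr; linarith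
        _ = 2 * η * (n * T) := by ring
        _ ≤ _ := by gcongr
    have b5 : M * (S - n * T) ≤ M * T := by gcongr; linarith
    linarith
  refine cauchy_map_iff_exists_tendsto.mp ?_
  rw [Metric.cauchy_iff]
  refine ⟨inferInstance, fun ε hε => ?_⟩
  obtain ⟨S₀, c, hc⟩ := key (ε / 8) (by positivity)
  refine ⟨_, image_mem_map (Ici_mem_atTop S₀), ?_⟩
  rintro _ ⟨s, hs, rfl⟩ _ ⟨t, ht, rfl⟩
  have h1 := hc s hs
  have h2 := hc t ht
  rw [← dist_eq_norm] at h1 h2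
  have := dist_triangle_right ((1 / s) • Φ s) ((1 / t) • Φ t) c
  linarith

theorem IsAlmostPeriodic.exists_average [CompleteSpace E] {g : ℝ → E}
    (hg : ContinuousOn g (Set.Ici 0)) (hap : IsAlmostPeriodic g) :
    ∃ A, Tendsto (fun T : ℝ => (1 / T) • ∫ t in (0 : ℝ)..T, g t) atTop (𝓝 A) := by
  obtain ⟨M, hM⟩ := hap.exists_bound hg
  have hM0 : 0 ≤ M := (norm_nonneg _).trans (hM 0 le_rfl)
  have hint : ∀ s t, 0 ≤ s → s ≤ t → ‖∫ u in s..t, g u‖ ≤ M * (t - s) := fun s t hs hst => by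
    have := intervalIntegral.norm_integral_le_of_norm_le_const (a := s) (b := t) (f := g)
      (C := M) fun u hu => hM u (by rw [Set.uIoc_of_le hst] at hu; linarith [hu.1])
    rwa [abs_of_nonneg (by linarith)] at this
  refine exists_tendsto_of_almost_additive (Φ := fun T => ∫ t in (0 : ℝ)..T, g t) (M := M)
    (by simp) (fun s t hs hst => ?_) (fun η hη => ?_)
  · rw [intervalIntegral.integral_interval_sub_left
      (hg.intervalIntegrable_of_Ici le_rfl (hs.trans hst)) (hg.intervalIntegrable_of_Ici le_rfl hs)]
    exact hint s t hs hst
  · obtain ⟨ℓ, hℓ, h⟩ := hap η hη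
    refine ⟨2 * (M * ℓ), by positivity, fun a T ha hT => ?_⟩
    obtain ⟨τ, hτ, hτ'⟩ := h a ha
    have hτ0 : 0 ≤ τ := ha.trans hτ.1
    have ii : ∀ {a b : ℝ}, 0 ≤ a → 0 ≤ b → IntervalIntegrable g MeasureTheory.volume a b :=
      fun ha hb => hg.intervalIntegrable_of_Ici ha hb
    have hshift : ∫ u in τ..(τ + T), g u = ∫ u in (0 : ℝ)..T, g (u + τ) := by
      rw [intervalIntegral.integral_comp_add_right (fun u => g u), zero_add, add_comm]
    -- Moving the window `[a, a + T]` to `[τ, τ + T]` leaves two end pieces of length `τ - a ≤ ℓ`;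
    -- on the moved window `g` is `η`-close to its values on `[0, T]`.
    have e : (∫ t in (0 : ℝ)..(a + T), g t) - (∫ t in (0 : ℝ)..a, g t) - ∫ t in (0 : ℝ)..T, g t =
        (∫ u in a..τ, g u) - (∫ u in (a + T)..(τ + T), g u)
          + ∫ u in (0 : ℝ)..T, (g (u + τ) - g u) := by
      rw [intervalIntegral.integral_sub, ← hshift,
        ← intervalIntegral.integral_add_adjacent_intervals (ii le_rfl ha)
          (ii ha (by positivity : 0 ≤ a + T)),
        ← intervalIntegral.integral_add_adjacent_intervals (ii ha hτ0)
          (ii hτ0 (by positivity : 0 ≤ a + T)),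
        ← intervalIntegral.integral_add_adjacent_intervals (ii hτ0 (by positivity : 0 ≤ a + T))
          (ii (by positivity) (by positivity : 0 ≤ τ + T))]
      · abel
      · have : ContinuousOn (fun u => g (u + τ)) (Set.Ici 0) :=
          hg.comp (by fun_prop) fun u hu => add_nonneg hu hτ0
        exact this.intervalIntegrable_of_Ici le_rfl hT
      · exact ii le_rfl hT
    rw [e]
    have b1 := hint a τ ha hτ.1
    have b2 := hint (a + T) (τ + T) (by positivity) (by linarith [hτ.1])
    have b3 : ‖∫ u in (0 : ℝ)..T, (g (u + τ) - g u)‖ ≤ η * T := by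
      have := intervalIntegral.norm_integral_le_of_norm_le_const (a := 0) (b := T)
        (f := fun u => g (u + τ) - g u) (C := η)
        fun u hu => (hτ' u (by rw [Set.uIoc_of_le hT] at hu; exact hu.1.le)).le
      rwa [sub_zero, abs_of_nonneg hT] at this
    have b4 : M * (τ - a) ≤ M * ℓ := by gcongr; linarith [hτ.2]
    refine (norm_add_le _ _).trans ((add_le_add_left (norm_sub_le _ _) _).trans ?_)
    have : τ + T - (a + T) = τ - a := by ring
    rw [this] at b2
    linarith

end Averages

/-! ### Consequences of periodicity and almost periodicity for vector fields. -/

section Fields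

variable {r : ℝ} {E : Type*} [NormedAddCommGroup E]

/-- `f` is bounded in time at every fixed state. -/
def BoundedInTime (f : ℝ → Hist r E → E) : Prop :=
  ∀ x : Hist r E, ∃ M, ∀ t : ℝ, 0 ≤ t → ‖f t x‖ ≤ M

theorem IsContinuousField.continuousOn_time {f : ℝ → Hist r E → E} (hf : IsContinuousField f)
    (x : Hist r E) : ContinuousOn (fun t => f t x) (Set.Ici 0) :=
  ContinuousOn.comp (g := Function.uncurry f) (f := fun t => (t, x)) hf (by fun_prop)
    fun _ ht => ⟨ht, trivial⟩

theorem AlmostPeriodicInTime.boundedInTime {f : ℝ → Hist r E → E} (hf : IsContinuousField f)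
    (hap : AlmostPeriodicInTime f) : BoundedInTime f := fun x =>
  IsAlmostPeriodic.exists_bound (hf.continuousOn_time x) (hap x)

theorem add_nat_mul_period {f : ℝ → Hist r E → E} {T : ℝ} (hT : 0 < T)
    (h : ∀ t : ℝ, 0 ≤ t → ∀ x : Hist r E, f (t + T) x = f t x) (n : ℕ) {t : ℝ} (ht : 0 ≤ t)
    (x : Hist r E) : f (t + n * T) x = f t x := by
  induction n with
  | zero => simp
  | succ n ih =>
    rw [← ih, ← h (t + n * T) (by positivity)]
    congr 1; push_cast; ring

theorem PeriodicInTime.almostPeriodicInTime {f : ℝ → Hist r E → E} (hp : PeriodicInTime f) :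
    AlmostPeriodicInTime f := by
  obtain ⟨T, hT, h⟩ := hp
  refine fun x η hη => ⟨T, hT, fun a ha => ⟨⌈a / T⌉₊ * T, ⟨?_, ?_⟩, fun t ht => ?_⟩⟩
  · rw [← div_le_iff₀ hT]; exact Nat.le_ceil _
  · have := (Nat.ceil_lt_add_one (div_nonneg ha hT.le)).le
    calc (⌈a / T⌉₊ : ℝ) * T ≤ (a / T + 1) * T := by gcongr
      _ = a + T := by field_simp
  · rw [add_nat_mul_period hT h _ ht, sub_self, norm_zero]; exact hη

/-- One period is compact, so joint continuity gives a radius valid throughout it; periodicity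
transports it to all later times. -/
theorem PeriodicInTime.uniformlyContinuousInState {f : ℝ → Hist r E → E}
    (hf : IsContinuousField f) (hp : PeriodicInTime f) : UniformlyContinuousInState f := by
  obtain ⟨T, hT, h⟩ := hp
  intro x η hη
  have hc : ContinuousOn (fun p : Hist r E × ℝ => f p.2 p.1 - f p.2 x)
      (Set.univ ×ˢ Set.Icc 0 T) := by
    refine ContinuousOn.sub (ContinuousOn.comp (g := Function.uncurry f)
      (f := fun p : Hist r E × ℝ => (p.2, p.1)) hf (by fun_prop) fun p hp => ⟨hp.2.1, trivial⟩) ?_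
    exact (hf.continuousOn_time x).comp (by fun_prop) fun p hp => hp.2.1
  have hev : ∀ᶠ x' in 𝓝 x, ∀ t ∈ Set.Icc (0 : ℝ) T, ‖f t x' - f t x‖ < η := by
    -- The membership `t ∈ [0, T]` is part of `P` because the eventual statement concerns full
    -- neighbourhoods, whereas continuity is only available within `[0, T]`.
    have := isCompact_Icc.eventually_forall_of_forall_eventually (x₀ := x)
      (K := Set.Icc (0 : ℝ) T) (P := fun x' t => t ∈ Set.Icc (0 : ℝ) T → ‖f t x' - f t x‖ < η) ?_
    · filter_upwards [this] with x' hx' t ht using hx' t ht ht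
    · intro t ht
      have h1 := (hc (x, t) ⟨trivial, ht⟩).norm
      have h2 : ∀ᶠ p in 𝓝[Set.univ ×ˢ Set.Icc 0 T] (x, t), ‖f p.2 p.1 - f p.2 x‖ < η :=
        h1.eventually_lt_const (by simpa using hη)
      rw [eventually_nhdsWithin_iff] at h2
      filter_upwards [h2] with p hp hpt using hp ⟨trivial, hpt⟩
  obtain ⟨ρ, hρ, hball⟩ := Metric.eventually_nhds_iff.mp hev
  refine ⟨ρ, hρ, fun x' hx' t ht => ?_⟩
  have hn : (⌊t / T⌋₊ : ℝ) * T ≤ t := by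
    rw [← le_div_iff₀ hT]; exact Nat.floor_le (by positivity)
  have hn' : t < (⌊t / T⌋₊ + 1 : ℝ) * T := by
    rw [← div_lt_iff₀ hT]; exact Nat.lt_floor_add_one _
  have := hball (by rwa [dist_eq_norm]) (t - ⌊t / T⌋₊ * T) ⟨by linarith, by linarith⟩
  rwa [← add_nat_mul_period hT h ⌊t / T⌋₊ (by linarith), ← add_nat_mul_period hT h ⌊t / T⌋₊
    (t := t - ⌊t / T⌋₊ * T) (by linarith) x, sub_add_cancel] at this

theorem UniformlyContinuousInState.of_eq_sum {n : ℕ} {f : ℝ → Hist r E → E}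
    {p : Fin n → ℝ → Hist r E → E} (hp : ∀ i, UniformlyContinuousInState (p i))
    (h : ∀ t : ℝ, 0 ≤ t → ∀ x : Hist r E, f t x = ∑ i, p i t x) :
    UniformlyContinuousInState f := by
  intro x η hη
  -- The denominator `n + 1` also covers the empty sum and keeps the final inequality strict.
  have hev : ∀ i, ∀ᶠ x' in 𝓝 x, ∀ t : ℝ, 0 ≤ t → ‖p i t x' - p i t x‖ < η / (n + 1) := fun i => by
    obtain ⟨ρ, hρ, H⟩ := hp i x (η / (n + 1)) (by positivity)
    exact Metric.eventually_nhds_iff.mpr ⟨ρ, hρ, fun x' hx' => H x' (by rwa [← dist_eq_norm])⟩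
  obtain ⟨ρ, hρ, H⟩ := Metric.eventually_nhds_iff.mp (eventually_all.mpr hev)
  refine ⟨ρ, hρ, fun x' hx' t ht => ?_⟩
  rw [h t ht, h t ht, ← Finset.sum_sub_distrib]
  calc ‖∑ i, (p i t x' - p i t x)‖ ≤ ∑ i, ‖p i t x' - p i t x‖ := norm_sum_le _ _
    _ ≤ ∑ _i : Fin n, η / (n + 1) :=
      Finset.sum_le_sum fun i _ => (H (by rwa [dist_eq_norm]) i t ht).le
    _ = n * (η / (n + 1)) := by simp
    _ < (n + 1) * (η / (n + 1)) := by gcongr; linarith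
    _ = η := by field_simp

theorem BoundedInTime.of_eq_sum {n : ℕ} {f : ℝ → Hist r E → E}
    {p : Fin n → ℝ → Hist r E → E} (hp : ∀ i, BoundedInTime (p i))
    (h : ∀ t : ℝ, 0 ≤ t → ∀ x : Hist r E, f t x = ∑ i, p i t x) :
    BoundedInTime f := by
  intro x
  choose M hM using fun i => hp i x
  refine ⟨∑ i, M i, fun t ht => ?_⟩
  rw [h t ht]
  exact norm_sum_le_of_le _ fun i _ => hM i t ht

variable [NormedSpace ℝ E]

theorem AlmostPeriodicInTime.exists_isTimeAverage [CompleteSpace E] {f : ℝ → Hist r E → E}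
    (hf : IsContinuousField f) (hap : AlmostPeriodicInTime f) : ∃ F, IsTimeAverage f F := by
  choose F hF using fun x => IsAlmostPeriodic.exists_average (hf.continuousOn_time x) (hap x)
  exact ⟨F, hF⟩

theorem IsTimeAverage.congr {f g : ℝ → Hist r E → E} {F : Hist r E → E} (hF : IsTimeAverage f F)
    (h : ∀ t : ℝ, 0 ≤ t → ∀ x : Hist r E, g t x = f t x) : IsTimeAverage g F := by
  refine fun x => (hF x).congr' ?_
  filter_upwards [eventually_ge_atTop 0] with T hT
  congr 1
  refine intervalIntegral.integral_congr fun t ht => (h t ?_ x).symm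
  rw [Set.uIcc_of_le hT] at ht
  exact ht.1

theorem IsTimeAverage.of_eq_sum {n : ℕ} {f : ℝ → Hist r E → E}
    {p : Fin n → ℝ → Hist r E → E} (hc : ∀ i, IsContinuousField (p i))
    {P : Fin n → Hist r E → E} (hp : ∀ i, IsTimeAverage (p i) (P i))
    (h : ∀ t : ℝ, 0 ≤ t → ∀ x : Hist r E, f t x = ∑ i, p i t x) :
    IsTimeAverage f fun x => ∑ i, P i x := by
  refine IsTimeAverage.congr (f := fun t x => ∑ i, p i t x) (fun x => ?_) h
  refine (tendsto_finsetSum Finset.univ fun i _ => hp i x).congr' ?_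
  filter_upwards [eventually_ge_atTop 0] with T hT
  rw [intervalIntegral.integral_finsetSum fun i _ =>
    ((hc i).continuousOn_time x).intervalIntegrable_of_Ici le_rfl hT, Finset.smul_sum]

end Fields

/-! ### Arzelà–Ascoli for Lipschitz paths. -/

section Compactness

variable {E : Type*} [NormedAddCommGroup E] [NormedSpace ℝ E] [FiniteDimensional ℝ E]

/-- Pinning `v b = 0` confines `v t` to a ball of radius `M * dist t b`, compact in finite
dimension; the common Lipschitz constant gives equicontinuity. Paths are later written as a fixed
path plus such a `v`. -/
theorem isCompact_setOf_lipschitzWith (M : ℝ≥0) (b : ℝ) :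
    IsCompact {v : C(ℝ, E) | LipschitzWith M v ∧ v b = 0} := by
  have : ProperSpace E := FiniteDimensional.proper ℝ E
  refine ArzelaAscoli.isCompact_of_equicontinuous _ ?_ ?_
  · have e : ContinuousMap.toFun '' {v : C(ℝ, E) | LipschitzWith M v ∧ v b = 0} =
        {g : ℝ → E | LipschitzWith M g ∧ g b = 0} := by
      ext g
      constructor
      · rintro ⟨v, hv, rfl⟩; exact hv
      · rintro ⟨h1, h2⟩; exact ⟨⟨g, h1.continuous⟩, ⟨h1, h2⟩, rfl⟩
    rw [e]
    refine (isCompact_univ_pi fun t : ℝ =>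
      isCompact_closedBall (0 : E) (M * dist t b)).of_isClosed_subset ?_ ?_
    · exact (isClosed_setOfPred_lipschitzWith M).inter
        (isClosed_eq (continuous_apply b) continuous_const)
    · rintro g ⟨h1, h2⟩ t -
      have := h1.dist_le_mul t b
      rwa [h2] at this
  · refine Metric.equicontinuous_of_continuity_modulus (fun s => M * s) ?_ _
      fun s t v => v.2.1.dist_le_mul s t
    have : Continuous fun s : ℝ => M * s := by fun_prop
    simpa using this.tendsto 0

theorem exists_subseq_tendsto_of_lipschitzWith {M : ℝ≥0} {b : ℝ} {v : ℕ → C(ℝ, E)}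
    (hv : ∀ n, LipschitzWith M (v n) ∧ v n b = 0) :
    ∃ w : C(ℝ, E), ∃ σ : ℕ → ℕ, StrictMono σ ∧ Tendsto (v ∘ σ) atTop (𝓝 w) := by
  obtain ⟨w, -, σ, hσ, hw⟩ := (isCompact_setOf_lipschitzWith M b).tendsto_subseq hv
  exact ⟨w, σ, hσ, hw⟩

end Compactness

/-! ### Histories of globally defined paths. -/

section History

variable {E : Type*} [NormedAddCommGroup E]

/-- The history `u_s` of a path `u` at time `s`. -/
def hist (r : ℝ) (u : C(ℝ, E)) (s : ℝ) : Hist r E :=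
  u.comp ⟨fun θ : Set.Icc (-r) (0 : ℝ) => s + θ, by fun_prop⟩

theorem hist_apply (r : ℝ) (u : C(ℝ, E)) (s : ℝ) (θ : Set.Icc (-r) (0 : ℝ)) :
    hist r u s θ = u (s + θ) := rfl

/-- Joint continuity in path and time, for locally uniform convergence of paths, is what allows
limits of solutions to be taken inside the equation. -/
theorem continuous_hist (r : ℝ) : Continuous fun p : C(ℝ, E) × ℝ => hist r p.1 p.2 := by
  have h : Continuous fun s : ℝ =>
      (⟨fun θ : Set.Icc (-r) (0 : ℝ) => s + θ, by fun_prop⟩ : C(Set.Icc (-r) (0 : ℝ), ℝ)) :=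
    ContinuousMap.continuous_of_continuous_uncurry _ (by
      change Continuous fun p : ℝ × Set.Icc (-r) (0 : ℝ) => p.1 + (p.2 : ℝ)
      fun_prop)
  exact (ContinuousMap.continuous_comp' (X := Set.Icc (-r) (0 : ℝ))).comp
    ((h.comp continuous_snd).prodMk continuous_fst)

theorem hist_congr {r : ℝ} {u v : C(ℝ, E)} {s : ℝ}
    (h : ∀ t ∈ Set.Icc (s - r) s, u t = v t) : hist r u s = hist r v s := by
  ext θ
  exact h (s + θ) ⟨by linarith [θ.2.1], by linarith [θ.2.2]⟩

theorem norm_hist_sub_le {r : ℝ} (hr : 0 ≤ r) {u v : C(ℝ, E)} {s c : ℝ}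
    (h : ∀ t ∈ Set.Icc (s - r) s, ‖u t - v t‖ ≤ c) : ‖hist r u s - hist r v s‖ ≤ c := by
  have hc : 0 ≤ c := (norm_nonneg _).trans (h s ⟨by linarith, le_rfl⟩)
  refine (ContinuousMap.norm_le _ hc).mpr fun θ => ?_
  exact h (s + θ) ⟨by linarith [θ.2.1], by linarith [θ.2.2]⟩

/-- The path that agrees with `x` on `[a, b]` and is constant on either side. -/
theorem exists_continuousMap_stopped {x : ℝ → E} {a b : ℝ} (hab : a ≤ b)
    (hx : ContinuousOn x (Set.Icc a b)) :
    ∃ u : C(ℝ, E), ∀ t, u t = x (max a (min t b)) :=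
  ⟨⟨fun t => x (max a (min t b)), hx.comp_continuous (by fun_prop)
    fun t => ⟨le_max_left _ _, max_le hab (min_le_right _ _)⟩⟩, fun _ => rfl⟩

theorem continuous_comp_hist {r : ℝ} {G : ℝ → Hist r E → E} (hG : Continuous (Function.uncurry G))
    (u : C(ℝ, E)) : Continuous fun s => G s (hist r u s) :=
  hG.comp (continuous_id.prodMk ((continuous_hist r).comp (continuous_const.prodMk continuous_id)))

end History

/-! ### Equivalence with the integral equation. -/

section Solutions

variable {r : ℝ} {E : Type*} [NormedAddCommGroup E] [NormedSpace ℝ E]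

theorem IsSolution.congr_field {g g' : ℝ → Hist r E → E} {φ : Hist r E} {I : Set ℝ} {x : ℝ → E}
    (hx : IsSolution g φ I x) (h : ∀ t, 0 ≤ t → g' t = g t) : IsSolution g' φ I x :=
  { hx with
    equation := fun t ht ht0 => by
      rw [h t ht0]; exact hx.equation t ht ht0 }

theorem IsMaximalSolution.congr_field {g g' : ℝ → Hist r E → E} {φ : Hist r E} {I : Set ℝ}
    {x : ℝ → E} (hx : IsMaximalSolution g φ I x) (h : ∀ t, 0 ≤ t → g' t = g t) :
    IsMaximalSolution g' φ I x :=
  ⟨hx.1.congr_field h, fun I' x' hx' => hx.2 I' x' (hx'.congr_field fun t ht => (h t ht).symm)⟩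

theorem IsSolution.Icc_subset_of_mem {g : ℝ → Hist r E → E} {φ : Hist r E} {I : Set ℝ} {x : ℝ → E}
    (hr : 0 ≤ r) (hx : IsSolution g φ I x) {b : ℝ} (hb : b ∈ I) : Set.Icc (-r) b ⊆ I :=
  hx.ordConnected.out (hx.Icc_subset ⟨le_rfl, by linarith⟩) hb

theorem IsSolution.hasDerivWithinAt_hist {g : ℝ → Hist r E → E} {φ : Hist r E} {I : Set ℝ}
    {x : ℝ → E} (hx : IsSolution g φ I x) {u : C(ℝ, E)} {t : ℝ} (ht : t ∈ I) (ht0 : 0 ≤ t)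
    (hu : ∀ s ∈ Set.Icc (-r) t, u s = x s) :
    HasDerivWithinAt x (g t (hist r u t)) (I ∩ Set.Ici 0) t := by
  obtain ⟨xt, h1, h2⟩ := hx.equation t ht ht0
  have : hist r u t = xt := by
    ext θ
    rw [hist_apply, h1]
    exact hu _ ⟨by linarith [θ.2.1], by linarith [θ.2.2]⟩
  rwa [this]

variable [CompleteSpace E]

theorem IsSolution.integral_eq {G : ℝ → Hist r E → E} (hG : Continuous (Function.uncurry G))
    {φ : Hist r E} {I : Set ℝ} {x : ℝ → E} (hr : 0 ≤ r) (hx : IsSolution G φ I x) {b : ℝ}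
    (hb : b ∈ I) {u : C(ℝ, E)} (hu : ∀ s ∈ Set.Icc (-r) b, u s = x s) :
    ∀ t ∈ Set.Icc 0 b, u t = u 0 + ∫ s in (0 : ℝ)..t, G s (hist r u s) := by
  intro t ht
  have hI := hx.Icc_subset_of_mem hr hb
  have := intervalIntegral.integral_eq_sub_of_hasDerivAt_of_le ht.1 (f := u)
    (f' := fun s => G s (hist r u s)) u.continuous.continuousOn ?_
    ((continuous_comp_hist hG u).intervalIntegrable _ _)
  · rw [this]; abel
  · intro s hs
    have hsb : s < b := hs.2.trans_le ht.2
    have h1 := hx.hasDerivWithinAt_hist (u := u) (hI ⟨by linarith [hs.1], hsb.le⟩) hs.1.le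
      fun s' hs' => hu s' ⟨hs'.1, hs'.2.trans hsb.le⟩
    have hmem : Set.Ioo 0 b ∈ 𝓝 s := Ioo_mem_nhds hs.1 hsb
    have h2 := h1.hasDerivAt (mem_of_superset hmem fun s' hs' =>
      ⟨hI ⟨by linarith [hs'.1], hs'.2.le⟩, hs'.1.le⟩)
    refine h2.congr_of_eventuallyEq ?_
    filter_upwards [hmem] with s' hs' using hu s' ⟨by linarith [hs'.1], hs'.2.le⟩

theorem isSolution_of_integral_eq {G : ℝ → Hist r E → E} (hG : Continuous (Function.uncurry G))
    {φ : Hist r E} (hr : 0 ≤ r) {b : ℝ} (hb : 0 < b) {u : C(ℝ, E)}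
    (hφ : ∀ θ : Set.Icc (-r) (0 : ℝ), u θ = φ θ)
    (hu : ∀ t ∈ Set.Icc 0 b, u t = u 0 + ∫ s in (0 : ℝ)..t, G s (hist r u s)) :
    IsSolution G φ (Set.Icc (-r) b) u where
  ordConnected := Set.ordConnected_Icc
  subset_Ici := fun _ ht => ht.1
  Icc_subset := Set.Icc_subset_Icc_right hb.le
  exists_pos := ⟨b, ⟨by linarith, le_rfl⟩, hb⟩
  continuousOn := u.continuous.continuousOn
  initial := hφ
  equation := fun t ht ht0 => by
    refine ⟨hist r u t, fun θ => rfl, ?_⟩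
    have h1 := ((continuous_comp_hist hG u).integral_hasStrictDerivAt 0 t).hasDerivAt.const_add (u 0)
    exact h1.hasDerivWithinAt.congr (fun s hs => hu s ⟨hs.2, hs.1.2⟩) (hu t ⟨ht0, ht.2⟩)

end Solutions

/-! ### Local existence by delayed approximations. -/

section Existence

variable {r : ℝ} {E : Type*} [NormedAddCommGroup E] [NormedSpace ℝ E]

/-- One step of Tonelli's delayed approximation: the path `u` enters only with delay `h`. -/
noncomputable def delayStep {G : ℝ → Hist r E → E} (hG : Continuous (Function.uncurry G))
    (x : C(ℝ, E)) (b h : ℝ) (u : C(ℝ, E)) : C(ℝ, E) where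
  toFun t := x (min t b) + ∫ s in b..max t b, G s (hist r u (s - h))
  continuous_toFun := by
    have hc : Continuous fun s => G s (hist r u (s - h)) :=
      hG.comp (continuous_id.prodMk ((continuous_hist r).comp
        (continuous_const.prodMk (continuous_id.sub continuous_const))))
    have := intervalIntegral.continuous_primitive (μ := MeasureTheory.volume) (fun a c => hc.intervalIntegrable a c) b
    exact (x.continuous.comp (by fun_prop)).add (this.comp (by fun_prop))

theorem delayStep_congr {G : ℝ → Hist r E → E} (hG : Continuous (Function.uncurry G))
    (x : C(ℝ, E)) {b h t : ℝ} {u v : C(ℝ, E)} (huv : ∀ s ≤ max t b - h, u s = v s) :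
    delayStep hG x b h u t = delayStep hG x b h v t := by
  simp only [delayStep, ContinuousMap.coe_mk]
  congr 1
  refine intervalIntegral.integral_congr fun s hs => ?_
  rw [Set.uIcc_of_le (le_max_right _ _)] at hs
  rw [hist_congr fun s' hs' => huv s' (by linarith [hs'.2, hs.2])]

theorem lipschitzWith_integral_max {g : ℝ → E} (hg : Continuous g) {M : ℝ≥0}
    (hM : ∀ s, ‖g s‖ ≤ M) (b : ℝ) : LipschitzWith M fun t => ∫ s in b..max t b, g s := by
  refine LipschitzWith.of_dist_le_mul fun s t => ?_
  rw [dist_eq_norm, intervalIntegral.integral_interval_sub_left (hg.intervalIntegrable _ _)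
    (hg.intervalIntegrable _ _)]
  refine (intervalIntegral.norm_integral_le_of_norm_le_const fun u _ => hM u).trans ?_
  gcongr
  exact abs_max_sub_max_le_abs s t b

/-- Because of the delay, every application of `delayStep` settles the path on a further stretch of
length `h`; about `1 / h` iterations reach `b + 1`. Here `v` is the increment after time `b`. -/
theorem exists_delayed_solution {G : ℝ → Hist r E → E} (hG : Continuous (Function.uncurry G))
    {M : ℝ≥0} (hM : ∀ t p, ‖G t p‖ ≤ M) (x : C(ℝ, E)) (b : ℝ) {h : ℝ} (hh : 0 < h) :
    ∃ v : C(ℝ, E), (LipschitzWith M v ∧ v b = 0) ∧ ∀ t ≤ b + 1,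
      v t = ∫ s in b..max t b,
        G s (hist r (x.comp ⟨fun t => min t b, by fun_prop⟩ + v) (s - h)) := by
  set Φ := delayStep hG x b h with hΦ
  have hstep : ∀ k : ℕ, ∀ t ≤ b + k * h, (Φ^[k + 1]) x t = (Φ^[k]) x t := by
    intro k
    induction k with
    | zero =>
      intro t ht
      have : t ≤ b := by simpa using ht
      simp [hΦ, delayStep, this]
    | succ k ih =>
      intro t ht
      rw [Function.iterate_succ_apply' _ (k + 1), Function.iterate_succ_apply' Φ k x]
      rw [← Function.iterate_succ_apply' Φ k x]
      conv_rhs => rw [Function.iterate_succ_apply']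
      refine delayStep_congr hG x fun s hs => ih s (hs.trans ?_)
      push_cast at ht
      have : 0 ≤ k * h := by positivity
      have := max_le (show t ≤ b + k * h + h by linarith) (show b ≤ b + k * h + h by linarith)
      linarith
  obtain ⟨N, hN⟩ := exists_nat_ge (1 / h)
  set u := (Φ^[N]) x with hu
  set w := (Φ^[N + 1]) x with hw
  have hwu : w = Φ u := by rw [hw, hu, Function.iterate_succ_apply']
  have hwe : ∀ t ≤ b + 1, w t = u t := fun t ht => hstep N t (by
    rw [div_le_iff₀ hh] at hN; linarith)
  have hc : Continuous fun s => G s (hist r u (s - h)) :=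
    hG.comp (continuous_id.prodMk ((continuous_hist r).comp
      (continuous_const.prodMk (continuous_id.sub continuous_const))))
  have hLip := lipschitzWith_integral_max hc (fun s => hM _ _) b
  -- The increment is built from the iterate `u`; adding the stopped `x` gives the next iterate `w`,
  -- which agrees with `u` up to `b + 1`.
  refine ⟨⟨fun t => ∫ s in b..max t b, G s (hist r u (s - h)), hLip.continuous⟩,
    ⟨hLip, by simp⟩, fun t ht => ?_⟩
  have hsum : x.comp ⟨fun t => min t b, by fun_prop⟩ +
      ⟨fun t => ∫ s in b..max t b, G s (hist r u (s - h)), hLip.continuous⟩ = w := by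
    rw [hwu]; rfl
  rw [hsum]
  simp only [ContinuousMap.coe_mk]
  refine intervalIntegral.integral_congr fun s hs => ?_
  rw [Set.uIcc_of_le (le_max_right _ _)] at hs
  rw [hist_congr fun s' hs' => hwe s' ?_]
  have := hs.2.trans (max_le ht (by linarith))
  linarith [hs'.2]

variable [FiniteDimensional ℝ E]

/-- Delayed solutions with delays `1 / (n + 1)` share the Lipschitz constant `M`, so a subsequence
converges; the delayed integral is continuous jointly in path and delay. -/
theorem exists_forward_solution_of_bounded {G : ℝ → Hist r E → E}
    (hG : Continuous (Function.uncurry G)) {M : ℝ≥0} (hM : ∀ t p, ‖G t p‖ ≤ M) (x : C(ℝ, E))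
    (b : ℝ) : ∃ u : C(ℝ, E), (∀ t ≤ b, u t = x t) ∧
      ∀ t ∈ Set.Icc b (b + 1), u t = x b + ∫ s in b..t, G s (hist r u s) := by
  have hh : ∀ n : ℕ, 0 < 1 / ((n : ℝ) + 1) := fun n => Nat.one_div_pos_of_nat
  choose v hv hve using fun n => exists_delayed_solution hG hM x b (hh n)
  obtain ⟨w, σ, hσ, hw⟩ := exists_subseq_tendsto_of_lipschitzWith hv
  set X : C(ℝ, E) := x.comp ⟨fun t => min t b, by fun_prop⟩ with hX
  have hlim : ∀ t ≤ b + 1, w t = ∫ s in b..max t b, G s (hist r (X + w) s) := by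
    intro t ht
    have h1 : Tendsto (fun n => v (σ n) t) atTop (𝓝 (w t)) :=
      ((continuous_eval_const (F := C(ℝ, E)) t).tendsto w).comp hw
    have hcont : Continuous fun p : C(ℝ, E) × ℝ =>
        ∫ s in b..max t b, G s (hist r (X + p.1) (s - p.2)) := by
      refine intervalIntegral.continuous_parametric_intervalIntegral_of_continuous' ?_ _ _
      refine hG.comp (continuous_snd.prodMk ((continuous_hist r).comp (Continuous.prodMk ?_ ?_)))
      · exact continuous_const.add (continuous_fst.comp continuous_fst)
      · exact continuous_snd.sub (continuous_snd.comp continuous_fst)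
    have h2 := (hcont.tendsto (w, 0)).comp (hw.prodMk_nhds
      ((tendsto_one_div_add_atTop_nhds_zero_nat (𝕜 := ℝ)).comp hσ.tendsto_atTop))
    refine tendsto_nhds_unique h1 (Tendsto.congr (fun n => ?_) (by simpa only [sub_zero] using h2))
    exact (hve (σ n) t ht).symm
  refine ⟨X + w, fun t ht => ?_, fun t ht => ?_⟩
  · have := hlim t (by linarith)
    rw [max_eq_right ht, intervalIntegral.integral_same] at this
    simp [this, hX, ht]
  · have := hlim t ht.2
    rw [max_eq_left ht.1] at this
    rw [ContinuousMap.add_apply, this]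
    simp [hX, ht.1]

/-- Peano's theorem: a solution on a compact interval can be continued to the right. -/
theorem IsSolution.exists_continuation {G : ℝ → Hist r E → E} (hr : 0 ≤ r)
    (hG : Continuous (Function.uncurry G)) {φ : Hist r E} {b : ℝ} {x : ℝ → E}
    (hx : IsSolution G φ (Set.Icc (-r) b) x) :
    ∃ c > b, ∃ x' : ℝ → E, IsSolution G φ (Set.Icc (-r) c) x' ∧
      Set.EqOn x' x (Set.Icc (-r) b) := by
  have : CompleteSpace E := FiniteDimensional.complete ℝ E
  have hb : 0 < b := by
    obtain ⟨t, ht, ht0⟩ := hx.exists_pos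
    exact ht0.trans_le ht.2
  have hbI : b ∈ Set.Icc (-r) b := ⟨by linarith, le_rfl⟩
  obtain ⟨X, hX⟩ := exists_continuousMap_stopped (show -r ≤ b by linarith) hx.continuousOn
  have hXx : ∀ t ∈ Set.Icc (-r) b, X t = x t := fun t ht => by
    rw [hX, min_eq_left ht.2, max_eq_right ht.1]
  have hXe := hx.integral_eq hG hr hbI hXx
  set M : ℝ≥0 := ‖G b (hist r X b)‖₊ + 1 with hM
  have hMpos : (0 : ℝ) < M := by positivity
  have hmax : ∀ v : E, 0 < max (M : ℝ) ‖v‖ := fun v => lt_max_of_lt_left hMpos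
  -- Radial truncation at norm `M` makes the field bounded. Since `M` exceeds the norm of `G` at
  -- time `b`, truncation is inactive along the new path for a short time after `b`.
  let g : ℝ → Hist r E → E := fun t p => ((M : ℝ) / max (M : ℝ) ‖G t p‖) • G t p
  have hgc : Continuous (Function.uncurry g) := by
    have hn : Continuous fun p : ℝ × Hist r E => max (M : ℝ) ‖Function.uncurry G p‖ :=
      continuous_const.max hG.norm
    exact (continuous_const.div hn fun p => (hmax _).ne').smul hG
  have hgM : ∀ t p, ‖g t p‖ ≤ M := fun t p => by
    simp only [g]
    rw [norm_smul, Real.norm_of_nonneg (div_nonneg hMpos.le (hmax _).le), div_mul_eq_mul_div,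
      div_le_iff₀ (hmax _)]
    gcongr
    exact le_max_right _ _
  obtain ⟨u, hu, hue⟩ := exists_forward_solution_of_bounded hgc hgM X b
  have hev : ∀ᶠ s in 𝓝 b, ‖G s (hist r u s)‖ < M := by
    refine (continuous_comp_hist hG u).norm.continuousAt.eventually_lt continuousAt_const ?_
    rw [hist_congr fun t ht => hu t ht.2, hM]
    push_cast
    exact lt_add_one _
  obtain ⟨ρ, hρ, hball⟩ := Metric.eventually_nhds_iff.mp hev
  set d := min (ρ / 2) 1 with hd
  have hd0 : 0 < d := by positivity
  refine ⟨b + d, by linarith, u, isSolution_of_integral_eq hG hr (by positivity) (fun θ => ?_)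
    (fun t ht => ?_), fun t ht => ?_⟩
  · have hθ : (θ : ℝ) ≤ b := θ.2.2.trans hb.le
    rw [hu _ hθ, hXx _ ⟨θ.2.1, hθ⟩, hx.initial]
  · have hlow : ∀ s ∈ Set.Icc 0 b, u s = u 0 + ∫ s' in (0 : ℝ)..s, G s' (hist r u s') := by
      intro s hs
      rw [hu s hs.2, hu 0 hb.le, hXe s hs]
      congr 1
      refine intervalIntegral.integral_congr fun s' hs' => ?_
      rw [Set.uIcc_of_le hs.1] at hs'
      rw [hist_congr fun t' ht' => hu t' (ht'.2.trans (hs'.2.trans hs.2))]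
    rcases le_total t b with htb | htb
    · exact hlow t ⟨ht.1, htb⟩
    · rw [hue t ⟨htb, ht.2.trans (by linarith [min_le_right (ρ / 2) 1])⟩, ← hu b le_rfl,
        hlow b ⟨hb.le, le_rfl⟩, add_assoc,
        ← intervalIntegral.integral_add_adjacent_intervals (a := 0) (b := b) (c := t)
          ((continuous_comp_hist hG u).intervalIntegrable _ _)
          ((continuous_comp_hist hG u).intervalIntegrable _ _)]
      congr 2
      refine intervalIntegral.integral_congr fun s hs => ?_
      rw [Set.uIcc_of_le htb] at hs
      have : ‖G s (hist r u s)‖ < M := hball (by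
        rw [Real.dist_eq, abs_of_nonneg (by linarith [hs.1])]
        linarith [hs.2, ht.2, min_le_left (ρ / 2) 1])
      simp only [g]
      rw [max_eq_left this.le, div_self hMpos.ne', one_smul]
  · rw [hu t ht.2, hXx t ht]

end Existence

/-! ### Estimates near compact sets of states, uniform in time. -/

section CompactUniformity

variable {r : ℝ} {E : Type*} [NormedAddCommGroup E]

/-- By the Lebesgue number lemma, `x` and `x'` lie in one ball on which `f t` varies by less than `η
/ 2` from its value at the centre; `x'` itself need not belong to `K`. -/
theorem UniformlyContinuousInState.exists_uniform_on_compact {f : ℝ → Hist r E → E}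
    (h : UniformlyContinuousInState f) {K : Set (Hist r E)} (hK : IsCompact K) {η : ℝ}
    (hη : 0 < η) : ∃ ρ > 0, ∀ x ∈ K, ∀ x', ‖x' - x‖ < ρ → ∀ t : ℝ, 0 ≤ t →
      ‖f t x' - f t x‖ < η := by
  choose ρ hρ H using fun x => h x (η / 2) (half_pos hη)
  obtain ⟨ε, hε, hball⟩ := lebesgue_number_lemma_of_metric hK
    (c := fun x => Metric.ball x (ρ x)) (fun x => Metric.isOpen_ball)
    fun x _ => Set.mem_iUnion.mpr ⟨x, Metric.mem_ball_self (hρ x)⟩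
  refine ⟨ε, hε, fun x hx x' hx' t ht => ?_⟩
  obtain ⟨z, hz⟩ := hball x hx
  have h1 := H z x (by simpa [dist_eq_norm] using hz (Metric.mem_ball_self hε)) t ht
  have h2 := H z x' (by
    rw [← dist_eq_norm]
    exact hz (by rwa [Metric.mem_ball, dist_eq_norm])) t ht
  have := norm_sub_le_norm_sub_add_norm_sub (f t x') (f t z) (f t x)
  rw [norm_sub_rev (f t z)] at this
  linarith

theorem BoundedInTime.exists_bound_near_compact {f : ℝ → Hist r E → E} (hb : BoundedInTime f)
    (h : UniformlyContinuousInState f) {K : Set (Hist r E)} (hK : IsCompact K) :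
    ∃ ρ > 0, ∃ M : ℝ≥0, ∀ x ∈ K, ∀ x', ‖x' - x‖ < ρ → ∀ t : ℝ, 0 ≤ t → ‖f t x'‖ ≤ M := by
  have hM : ∃ M : ℝ, ∀ x ∈ K, ∀ t : ℝ, 0 ≤ t → ‖f t x‖ ≤ M := by
    refine hK.induction_on (p := fun S => ∃ M : ℝ, ∀ x ∈ S, ∀ t : ℝ, 0 ≤ t → ‖f t x‖ ≤ M)
      ⟨0, by simp⟩ ?_ ?_ ?_
    · rintro S S' hS ⟨M, hM⟩
      exact ⟨M, fun x hx => hM x (hS hx)⟩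
    · rintro S S' ⟨M, hM⟩ ⟨M', hM'⟩
      refine ⟨max M M', ?_⟩
      rintro x (hx | hx) t ht
      exacts [(hM x hx t ht).trans (le_max_left _ _), (hM' x hx t ht).trans (le_max_right _ _)]
    · intro x _
      obtain ⟨M, hM⟩ := hb x
      obtain ⟨ρ, hρ, H⟩ := h x 1 one_pos
      refine ⟨Metric.ball x ρ, mem_nhdsWithin_of_mem_nhds (Metric.ball_mem_nhds x hρ), M + 1,
        fun x' hx' t ht => ?_⟩
      have h1 := H x' (by rwa [← dist_eq_norm]) t ht
      have h2 := norm_le_norm_add_norm_sub' (f t x') (f t x)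
      linarith [hM t ht]
  obtain ⟨M, hM⟩ := hM
  obtain ⟨ρ, hρ, H⟩ := h.exists_uniform_on_compact hK one_pos
  refine ⟨ρ, hρ, (M + 1).toNNReal, fun x hx x' hx' t ht => ?_⟩
  have h1 := H x hx x' hx' t ht
  have h2 := norm_le_norm_add_norm_sub' (f t x') (f t x)
  have h3 := hM x hx t ht
  exact le_trans (by linarith) (Real.le_coe_toNNReal (M + 1))

end CompactUniformity

/-! ### Convergence of rapidly oscillating integrals. -/

section AveragingLimit

variable {r : ℝ} {E : Type*} [NormedAddCommGroup E] [NormedSpace ℝ E]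

/-- Averaging preserves time-uniform estimates; hence `F` is continuous. -/
theorem IsTimeAverage.norm_sub_le {f : ℝ → Hist r E → E} {F : Hist r E → E}
    (hf : Continuous (Function.uncurry f)) (hF : IsTimeAverage f F) {x x' : Hist r E} {η : ℝ}
    (h : ∀ t : ℝ, 0 ≤ t → ‖f t x' - f t x‖ ≤ η) : ‖F x' - F x‖ ≤ η := by
  have hc : ∀ x, Continuous fun t => f t x := fun x => hf.comp (by fun_prop : Continuous fun t => (t, x))
  refine le_of_tendsto ((hF x').sub (hF x)).norm ?_
  filter_upwards [eventually_gt_atTop 0] with T hT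
  rw [← smul_sub, ← intervalIntegral.integral_sub ((hc x').intervalIntegrable _ _)
    ((hc x).intervalIntegrable _ _), norm_smul, Real.norm_of_nonneg (by positivity), one_div,
    inv_mul_le_iff₀ hT]
  have := intervalIntegral.norm_integral_le_of_norm_le_const (a := 0) (b := T)
    (f := fun u => f u x' - f u x) (C := η)
    fun u hu => h u (by rw [Set.uIoc_of_le hT.le] at hu; exact hu.1.le)
  rwa [sub_zero, abs_of_pos hT, mul_comm] at this

theorem IsTimeAverage.continuous {f : ℝ → Hist r E → E} {F : Hist r E → E}
    (hf : Continuous (Function.uncurry f)) (h : UniformlyContinuousInState f)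
    (hF : IsTimeAverage f F) : Continuous F := by
  refine continuous_iff_continuousAt.mpr fun x => Metric.continuousAt_iff.mpr fun η hη => ?_
  obtain ⟨ρ, hρ, H⟩ := h x (η / 2) (half_pos hη)
  refine ⟨ρ, hρ, fun {x'} hx' => ?_⟩
  rw [dist_eq_norm] at hx' ⊢
  exact (hF.norm_sub_le hf fun t ht => (H x' hx' t ht).le).trans_lt (half_lt_self hη)

variable {ε : ℕ → ℝ}

/-- Rescaling time turns the integral over `[0, c]` into `c` times the mean over `[0, c / ε n]`, a
window of length tending to infinity. -/
theorem IsTimeAverage.tendsto_integral_const {f : ℝ → Hist r E → E} {F : Hist r E → E}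
    (hf : Continuous (Function.uncurry f)) (hF : IsTimeAverage f F) (hε : ∀ n, 0 < ε n)
    (hε0 : Tendsto ε atTop (𝓝 0)) (x : Hist r E) {a c : ℝ} (ha : 0 ≤ a) (hc : 0 ≤ c) :
    Tendsto (fun n => ∫ s in a..c, f (s / ε n) x) atTop (𝓝 ((c - a) • F x)) := by
  have hcont : ∀ n, Continuous fun s => f (s / ε n) x := fun n =>
    hf.comp (by fun_prop : Continuous fun s : ℝ => (s / ε n, x))
  have h0 : ∀ c : ℝ, 0 ≤ c → Tendsto (fun n => ∫ s in (0 : ℝ)..c, f (s / ε n) x) atTop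
      (𝓝 (c • F x)) := by
    intro c hc
    rcases hc.eq_or_lt with rfl | hc
    · simp
    have hT : Tendsto (fun n => c / ε n) atTop atTop := by
      simp only [div_eq_mul_inv]
      exact ((tendsto_inv_nhdsGT_zero.comp (tendsto_nhdsWithin_iff.mpr
        ⟨hε0, Eventually.of_forall hε⟩))).const_mul_atTop hc
    refine (((hF x).comp hT).const_smul c).congr fun n => ?_
    have := (hε n).ne'
    rw [intervalIntegral.integral_comp_div (fun s => f s x) this, Function.comp_apply, smul_smul,
      zero_div]
    congr 1
    field_simp
  rw [sub_smul]
  refine ((h0 c hc).sub (h0 a ha)).congr fun n => ?_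
  exact intervalIntegral.integral_interval_sub_left ((hcont n).intervalIntegrable _ _)
    ((hcont n).intervalIntegrable _ _)

theorem IsTimeAverage.tendsto_integral_comp [CompleteSpace E] {f : ℝ → Hist r E → E} {F : Hist r E → E}
    (hf : Continuous (Function.uncurry f)) (h : UniformlyContinuousInState f)
    (hF : IsTimeAverage f F) (hε : ∀ n, 0 < ε n) (hε0 : Tendsto ε atTop (𝓝 0))
    {w : ℝ → Hist r E} (hw : Continuous w) {T : ℝ} (hT : 0 ≤ T) :
    Tendsto (fun n => ∫ s in (0 : ℝ)..T, f (s / ε n) (w s)) atTop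
      (𝓝 (∫ s in (0 : ℝ)..T, F (w s))) := by
  have hFc : Continuous fun s => F (w s) := (hF.continuous hf h).comp hw
  have hfc : ∀ n, Continuous fun s => f (s / ε n) (w s) := fun n =>
    hf.comp (by fun_prop : Continuous fun s : ℝ => (s / ε n, w s))
  have hfx : ∀ n x, Continuous fun s => f (s / ε n) x := fun n x =>
    hf.comp (by fun_prop : Continuous fun s : ℝ => (s / ε n, x))
  set D : ℕ → ℝ → E := fun n t => ∫ s in (0 : ℝ)..t, (f (s / ε n) (w s) - F (w s)) with hD
  have hDc : ∀ n, Continuous fun s => f (s / ε n) (w s) - F (w s) := fun n => (hfc n).sub hFc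
  -- On steps of length `σ / 2`, `w` is frozen at the left end point. Freezing costs `η` for `f` and
  -- `η` for `F` per unit time; `κ` absorbs the errors of the finitely many frozen limits.
  have key : ∀ η > 0, ∀ κ > 0, ∀ᶠ n in atTop, ‖D n T‖ ≤ 2 * η * T + κ := by
    intro η hη
    obtain ⟨ρ, hρ, H⟩ := h.exists_uniform_on_compact
      ((isCompact_Icc (a := 0) (b := T)).image hw) hη
    obtain ⟨σ, hσ, hσ'⟩ := Metric.uniformContinuousOn_iff.mp
      ((isCompact_Icc (a := 0) (b := T)).uniformContinuousOn_of_continuous hw.continuousOn) ρ hρ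
    have ind : ∀ k : ℕ, ∀ t ∈ Set.Icc 0 T, t ≤ k * (σ / 2) → ∀ κ > 0, ∀ᶠ n in atTop,
        ‖D n t‖ ≤ 2 * η * t + κ := by
      intro k
      induction k with
      | zero =>
        intro t ht htk κ hκ
        have : t = 0 := le_antisymm (by simpa using htk) ht.1
        subst this
        simp [hD, hκ.le]
      | succ k ih =>
        intro t ht htk κ hκ
        rcases le_total t (k * (σ / 2)) with hle | hle
        · exact ih t ht hle κ hκ
        set a := (k : ℝ) * (σ / 2) with ha
        have ha0 : 0 ≤ a := by positivity
        have haT : a ∈ Set.Icc 0 T := ⟨ha0, hle.trans ht.2⟩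
        have htσ : t - a < σ := by
          push_cast at htk
          rw [add_mul, one_mul, ← ha] at htk
          linarith
        have hlim := (hF.tendsto_integral_const hf hε hε0 (w a) ha0 ht.1).sub_const
          ((t - a) • F (w a))
        rw [sub_self] at hlim
        filter_upwards [ih a haT le_rfl (κ / 2) (half_pos hκ),
          hlim.norm.eventually_le_const (u := κ / 2) (by simpa using hκ)] with n hn1 hn2
        have e : D n t = D n a + ((∫ s in a..t, ((f (s / ε n) (w s) - f (s / ε n) (w a)) -
            (F (w s) - F (w a)))) + ((∫ s in a..t, f (s / ε n) (w a)) - (t - a) • F (w a))) := by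
          have hc1 : Continuous fun s => f (s / ε n) (w s) - f (s / ε n) (w a) -
              (F (w s) - F (w a)) := ((hfc n).sub (hfx n (w a))).sub (hFc.sub continuous_const)
          have hc2 : Continuous fun s => f (s / ε n) (w a) - F (w a) :=
            (hfx n (w a)).sub continuous_const
          have e1 : (t - a) • F (w a) = ∫ _s in a..t, F (w a) := by simp
          rw [e1, ← intervalIntegral.integral_sub ((hfx n (w a)).intervalIntegrable _ _)
            (continuous_const.intervalIntegrable _ _), ← intervalIntegral.integral_add
            (hc1.intervalIntegrable _ _) (hc2.intervalIntegrable _ _)]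
          simp only [hD]
          rw [← intervalIntegral.integral_add_adjacent_intervals (b := a)
            ((hDc n).intervalIntegrable _ _) ((hDc n).intervalIntegrable _ _)]
          congr 1
          refine intervalIntegral.integral_congr fun s _ => ?_
          abel
        have hmid : ‖∫ s in a..t, ((f (s / ε n) (w s) - f (s / ε n) (w a)) -
            (F (w s) - F (w a)))‖ ≤ 2 * η * (t - a) := by
          rw [← abs_of_nonneg (sub_nonneg.mpr hle)]
          refine intervalIntegral.norm_integral_le_of_norm_le_const fun s hs => ?_
          rw [Set.uIoc_of_le hle] at hs
          have hsT : s ∈ Set.Icc 0 T := ⟨ha0.trans hs.1.le, hs.2.trans ht.2⟩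
          have hclose : ‖w s - w a‖ < ρ := by
            rw [← dist_eq_norm]
            refine hσ' s hsT a haT ?_
            rw [Real.dist_eq, abs_of_nonneg (by linarith [hs.1])]
            linarith [hs.2]
          have h1 := H (w a) (Set.mem_image_of_mem w haT) (w s) hclose
          have h2 := hF.norm_sub_le hf fun t ht => (h1 t ht).le
          have h3 := h1 (s / ε n) (div_nonneg hsT.1 (hε n).le)
          refine (_root_.norm_sub_le _ _).trans ?_
          linarith
        rw [e]
        refine (norm_add_le _ _).trans ((add_le_add_right (norm_add_le _ _) _).trans ?_)
        linarith
    obtain ⟨k, hk⟩ := exists_nat_ge (T / (σ / 2))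
    rw [div_le_iff₀ (half_pos hσ)] at hk
    exact ind k T ⟨hT, le_rfl⟩ hk
  have hD0 : Tendsto (fun n => D n T) atTop (𝓝 0) := by
    rw [tendsto_zero_iff_norm_tendsto_zero]
    refine tendsto_order.mpr ⟨fun c hc => Eventually.of_forall fun n => hc.trans_le (norm_nonneg _),
      fun c hc => ?_⟩
    have hη : 0 < c / (8 * (T + 1)) := by positivity
    filter_upwards [key _ hη (c / 2) (half_pos hc)] with n hn
    refine hn.trans_lt ?_
    have : c / (8 * (T + 1)) * T ≤ c / 8 := by
      rw [div_mul_eq_mul_div, div_le_div_iff₀ (by positivity) (by positivity)]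
      nlinarith
    linarith
  refine (by simpa using hD0.add_const (∫ s in (0 : ℝ)..T, F (w s)) :
    Tendsto (fun n => D n T + ∫ s in (0 : ℝ)..T, F (w s)) _ _).congr fun n => ?_
  simp only [hD]
  rw [intervalIntegral.integral_sub ((hfc n).intervalIntegrable _ _) (hFc.intervalIntegrable _ _),
    sub_add_cancel]

/-- The histories of `u n` approach those of `v` uniformly on `[0, T]`, and the latter are compact,
so replacing `u n` by `v` costs little at every rescaled time `s / ε n`. -/
theorem IsTimeAverage.tendsto_integral_hist [CompleteSpace E] {f : ℝ → Hist r E → E}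
    {F : Hist r E → E} (hf : Continuous (Function.uncurry f)) (h : UniformlyContinuousInState f)
    (hF : IsTimeAverage f F) (hε : ∀ n, 0 < ε n) (hε0 : Tendsto ε atTop (𝓝 0))
    {u : ℕ → C(ℝ, E)} {v : C(ℝ, E)} (hu : Tendsto u atTop (𝓝 v)) {T : ℝ} (hT : 0 ≤ T) :
    Tendsto (fun n => ∫ s in (0 : ℝ)..T, f (s / ε n) (hist r (u n) s)) atTop
      (𝓝 (∫ s in (0 : ℝ)..T, F (hist r v s))) := by
  have hhist : ∀ u : C(ℝ, E), Continuous fun s => hist r u s := fun u =>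
    (continuous_hist r).comp (continuous_const.prodMk continuous_id)
  have hfc : ∀ n (u : C(ℝ, E)), Continuous fun s => f (s / ε n) (hist r u s) := fun n u =>
    hf.comp ((continuous_id.div_const _).prodMk (hhist u))
  refine (hF.tendsto_integral_comp hf h hε hε0 (hhist v) hT).congr_dist ?_
  refine tendsto_order.mpr ⟨fun c hc => Eventually.of_forall fun n => hc.trans_le dist_nonneg,
    fun c hc => ?_⟩
  have hη : 0 < c / (T + 1) := by positivity
  obtain ⟨ρ, hρ, H⟩ := h.exists_uniform_on_compact
    ((isCompact_Icc (a := 0) (b := T)).image (hhist v)) hη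
  have hev : ∀ᶠ u in 𝓝 v, ∀ s ∈ Set.Icc 0 T, ‖hist r u s - hist r v s‖ < ρ := by
    refine isCompact_Icc.eventually_forall_of_forall_eventually fun s _ => ?_
    have hcont : Continuous fun p : C(ℝ, E) × ℝ => ‖hist r p.1 p.2 - hist r v p.2‖ :=
      ((continuous_hist r).sub ((hhist v).comp continuous_snd)).norm
    exact (hcont.tendsto (v, s)).eventually_lt_const (by simpa using hρ)
  filter_upwards [hu.eventually hev] with n hn
  rw [dist_comm, dist_eq_norm, ← intervalIntegral.integral_sub
    ((hfc n (u n)).intervalIntegrable _ _) ((hfc n v).intervalIntegrable _ _)]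
  have hle := intervalIntegral.norm_integral_le_of_norm_le_const (a := 0) (b := T)
    (f := fun s => f (s / ε n) (hist r (u n) s) - f (s / ε n) (hist r v s)) (C := c / (T + 1))
    fun s hs => by
      rw [Set.uIoc_of_le hT] at hs
      have hs' : s ∈ Set.Icc 0 T := ⟨hs.1.le, hs.2⟩
      exact (H _ (Set.mem_image_of_mem _ hs') _ (hn s hs') _ (div_nonneg hs'.1 (hε n).le)).le
  rw [sub_zero, abs_of_nonneg hT] at hle
  refine hle.trans_lt ?_
  rw [div_mul_eq_mul_div, div_lt_iff₀ (by positivity)]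
  nlinarith

end AveragingLimit

/-! ### Continuation of solutions that stay near a given path. -/

section Continuation

variable {r : ℝ} {E : Type*} [NormedAddCommGroup E] [NormedSpace ℝ E]

/-- The extension of an initial history to `ℝ` that is constant outside `[-r, 0]`. -/
noncomputable def extendHist (hr : 0 ≤ r) (φ : Hist r E) : C(ℝ, E) :=
  ⟨Set.IccExtend (neg_nonpos.mpr hr) φ, φ.continuous.Icc_extend'⟩

/-- A solution stopped at time `c` is the initial history plus a Lipschitz path from `0`. -/
theorem IsSolution.exists_stopped {G : ℝ → Hist r E → E} {φ : Hist r E} {I : Set ℝ} {x : ℝ → E}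
    (hr : 0 ≤ r) (hx : IsSolution G φ I x) {c : ℝ} (hc0 : 0 ≤ c) {M : ℝ≥0}
    (hM : LipschitzOnWith M x (Set.Icc 0 c)) :
    ∃ v : C(ℝ, E), (LipschitzWith M v ∧ v 0 = 0) ∧
      ∀ t ∈ Set.Icc (-r) c, (extendHist hr φ + v) t = x t := by
  have hmem : ∀ t, max 0 (min t c) ∈ Set.Icc 0 c := fun t =>
    ⟨le_max_left _ _, max_le hc0 (min_le_right _ _)⟩
  have hL : LipschitzWith M fun t => x (max 0 (min t c)) - x 0 := by
    refine LipschitzWith.of_dist_le_mul fun s t => ?_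
    rw [dist_sub_right]
    refine (hM.dist_le_mul _ (hmem s) _ (hmem t)).trans ?_
    gcongr
    rw [Real.dist_eq, Real.dist_eq, max_comm 0, max_comm 0]
    refine (abs_max_sub_max_le_abs _ _ _).trans ?_
    simpa using abs_min_sub_min_le_max s c t c
  refine ⟨⟨_, hL.continuous⟩, ⟨hL, by simp [hc0]⟩, fun t ht => ?_⟩
  have hφ : ∀ s (hs : s ∈ Set.Icc (-r) 0), extendHist hr φ s = x s := fun s hs => by
    rw [hx.initial ⟨s, hs⟩]
    exact Set.IccExtend_of_mem _ _ hs
  rw [ContinuousMap.add_apply]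
  simp only [ContinuousMap.coe_mk]
  rcases le_total t 0 with h0 | h0
  · rw [hφ t ⟨ht.1, h0⟩, min_eq_left ht.2, max_eq_left h0, sub_self, add_zero]
  · have : extendHist hr φ t = x 0 := by
      rw [← hφ 0 ⟨by linarith, le_rfl⟩]
      simp only [extendHist, ContinuousMap.coe_mk]
      rw [Set.IccExtend_of_right_le _ _ h0, Set.IccExtend_right]
    rw [this, min_eq_left ht.2, max_eq_right h0]
    abel

/-- Both paths equal `φ` before time `0`, so closeness on `[0, b]` makes whole histories `δ`-close;
then `M` bounds the derivative. -/
theorem IsSolution.lipschitzOnWith_of_near {G : ℝ → Hist r E → E} (hr : 0 ≤ r)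
    {φ : Hist r E} {I : Set ℝ} {x : ℝ → E} (hx : IsSolution G φ I x) {Y : C(ℝ, E)}
    (hY : ∀ θ : Set.Icc (-r) (0 : ℝ), Y θ = φ θ) {L ρ δ : ℝ} (hδ : 0 < δ) (hδρ : δ < ρ) {M : ℝ≥0}
    (hM : ∀ s ∈ Set.Icc 0 L, ∀ p, ‖p - hist r Y s‖ < ρ → ∀ t, 0 ≤ t → ‖G t p‖ ≤ M)
    {b : ℝ} (hb : b ∈ I) (hb0 : 0 ≤ b) (hbL : b ≤ L)
    (hnear : ∀ t ∈ Set.Icc 0 b, ‖x t - Y t‖ ≤ δ) : LipschitzOnWith M x (Set.Icc 0 b) := by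
  have hI := hx.Icc_subset_of_mem hr hb
  obtain ⟨u, hu⟩ := exists_continuousMap_stopped (show -r ≤ b by linarith)
    (hx.continuousOn.mono hI)
  have hux : ∀ t ∈ Set.Icc (-r) b, u t = x t := fun t ht => by
    rw [hu, min_eq_left ht.2, max_eq_right ht.1]
  refine (convex_Icc 0 b).lipschitzOnWith_of_nnnorm_hasDerivWithin_le
    (f' := fun t => G t (hist r u t)) (fun t ht => ?_) (fun t ht => ?_)
  · refine (hx.hasDerivWithinAt_hist (u := u) (hI ⟨by linarith [ht.1], ht.2⟩) ht.1 fun s hs =>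
      hux s ⟨hs.1, hs.2.trans ht.2⟩).mono fun s hs => ⟨hI ⟨by linarith [hs.1], hs.2⟩, hs.1⟩
  · refine hM t ⟨ht.1, ht.2.trans hbL⟩ _ ((norm_hist_sub_le hr (c := δ) fun s hs => ?_).trans_lt hδρ)
      t ht.1
    have hs1 : -r ≤ s := by linarith [hs.1, ht.1]
    rw [hux s ⟨hs1, hs.2.trans ht.2⟩]
    rcases le_total s 0 with h0 | h0
    · rw [hx.initial ⟨s, hs1, h0⟩, hY ⟨s, hs1, h0⟩, sub_self, norm_zero]
      exact hδ.le
    · exact hnear s ⟨h0, hs.2.trans ht.2⟩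

variable [FiniteDimensional ℝ E]

/-- A Lipschitz solution on a half-open interval extends to its right end point. -/
theorem IsSolution.exists_extension_right {G : ℝ → Hist r E → E} (hr : 0 ≤ r)
    (hG : Continuous (Function.uncurry G)) {φ : Hist r E} {I : Set ℝ} {x : ℝ → E}
    (hx : IsSolution G φ I x) {b : ℝ} (hb : 0 < b) (hI : Set.Ico (-r) b ⊆ I) {M : ℝ≥0}
    (hM : ∀ c ∈ Set.Ico 0 b, LipschitzOnWith M x (Set.Icc 0 c)) :
    ∃ x' : ℝ → E, IsSolution G φ (Set.Icc (-r) b) x' ∧ Set.EqOn x' x (Set.Ico (-r) b) := by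
  have : CompleteSpace E := FiniteDimensional.complete ℝ E
  obtain ⟨c, -, hcb, hclim⟩ := exists_seq_strictMono_tendsto' hb
  -- Stopping `x` at times `c n` increasing to `b` gives globally defined paths to which compactness
  -- applies; the limit supplies the missing value at `b`.
  choose v hv hvx using fun n => hx.exists_stopped hr (hcb n).1.le (hM (c n) ⟨(hcb n).1.le, (hcb n).2⟩)
  obtain ⟨w, σ, hσ, hw⟩ := exists_subseq_tendsto_of_lipschitzWith hv
  set u := extendHist hr φ + w with hu
  have hux : ∀ t ∈ Set.Ico (-r) b, u t = x t := by
    intro t ht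
    have h1 : Tendsto (fun n => (extendHist hr φ + v (σ n)) t) atTop (𝓝 (u t)) :=
      ((continuous_eval_const (F := C(ℝ, E)) t).tendsto u).comp (hw.const_add _)
    refine tendsto_nhds_unique_of_eventuallyEq h1 tendsto_const_nhds ?_
    filter_upwards [(hclim.comp hσ.tendsto_atTop).eventually (lt_mem_nhds ht.2)] with n hn
    exact hvx _ t ⟨ht.1, hn.le⟩
  have heq : ∀ t ∈ Set.Ico 0 b, u t = u 0 + ∫ s in (0 : ℝ)..t, G s (hist r u s) := fun t ht =>
    hx.integral_eq hG hr (hI ⟨by linarith [ht.1], ht.2⟩)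
      (fun s hs => hux s ⟨hs.1, hs.2.trans_lt ht.2⟩) t ⟨ht.1, le_rfl⟩
  have hcl : Set.EqOn u (fun t => u 0 + ∫ s in (0 : ℝ)..t, G s (hist r u s)) (Set.Icc 0 b) := by
    rw [← closure_Ico hb.ne]
    refine Set.EqOn.closure heq u.continuous ?_
    exact continuous_const.add (intervalIntegral.continuous_primitive
      (fun a c => (continuous_comp_hist hG u).intervalIntegrable a c) 0)
  refine ⟨u, isSolution_of_integral_eq hG hr hb (fun θ => ?_) hcl, hux⟩
  rw [hux θ ⟨θ.2.1, θ.2.2.trans_lt hb⟩, hx.initial]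

/-- A maximal solution which does not stay near `Y` up to time `L` reaches distance `δ` from `Y`
at some time before which it is Lipschitz. -/
theorem IsMaximalSolution.exists_exit_time {G : ℝ → Hist r E → E} (hr : 0 ≤ r)
    (hG : Continuous (Function.uncurry G)) {φ : Hist r E} {I : Set ℝ} {x : ℝ → E}
    (hx : IsMaximalSolution G φ I x) {Y : C(ℝ, E)}
    (hY : ∀ θ : Set.Icc (-r) (0 : ℝ), Y θ = φ θ) {L ρ δ : ℝ} (hδ : 0 < δ) (hδρ : δ < ρ) {M : ℝ≥0}
    (hM : ∀ s ∈ Set.Icc 0 L, ∀ p, ‖p - hist r Y s‖ < ρ → ∀ t, 0 ≤ t → ‖G t p‖ ≤ M)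
    (hbad : ¬ (Set.Icc (-r) L ⊆ I ∧ ∀ t ∈ Set.Icc 0 L, ‖x t - Y t‖ < δ)) :
    ∃ b ∈ I, 0 < b ∧ b ≤ L ∧ LipschitzOnWith M x (Set.Icc 0 b) ∧ ‖x b - Y b‖ = δ := by
  by_cases hfar : ∃ t ∈ I, 0 ≤ t ∧ t ≤ L ∧ δ ≤ ‖x t - Y t‖
  · obtain ⟨c, hcI, hc0, hcL, hcδ⟩ := hfar
    have hI := hx.1.Icc_subset_of_mem hr hcI
    obtain ⟨u, hu⟩ := exists_continuousMap_stopped (show -r ≤ c by linarith)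
      (hx.1.continuousOn.mono hI)
    have hux : ∀ t ∈ Set.Icc 0 c, u t = x t := fun t ht => by
      rw [hu, min_eq_left ht.2, max_eq_right (by linarith [ht.1])]
    have hgc : Continuous fun t => ‖u t - Y t‖ := (u.continuous.sub Y.continuous).norm
    have hcomp : IsCompact (Set.Icc 0 c ∩ {t | δ ≤ ‖u t - Y t‖}) :=
      isCompact_Icc.inter_right (isClosed_le continuous_const hgc)
    -- The exit time is the first time at distance at least `δ`; continuity makes the distance there
    -- exactly `δ`.
    obtain ⟨b, ⟨hbc, hbδ⟩, hmin⟩ := hcomp.exists_isLeast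
      ⟨c, ⟨hc0, le_rfl⟩, by rw [Set.mem_ofPred_eq, hux c ⟨hc0, le_rfl⟩]; exact hcδ⟩
    rw [Set.mem_ofPred_eq] at hbδ
    have hlt : ∀ t ∈ Set.Ico 0 b, ‖u t - Y t‖ < δ := fun t ht => by
      by_contra hcon
      have := hmin ⟨⟨ht.1, ht.2.le.trans hbc.2⟩, not_lt.mp hcon⟩
      linarith [ht.2]
    have hb0 : 0 < b := by
      refine hbc.1.lt_of_ne ?_
      rintro rfl
      have h0 : (0 : ℝ) ∈ Set.Icc (-r) 0 := ⟨by linarith, le_rfl⟩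
      rw [hux 0 ⟨le_rfl, hc0⟩, hx.1.initial ⟨0, h0⟩, hY ⟨0, h0⟩, sub_self, norm_zero] at hbδ
      linarith
    have hle : ∀ t ∈ Set.Icc 0 b, ‖u t - Y t‖ ≤ δ := by
      have hcl : IsClosed {t | ‖u t - Y t‖ ≤ δ} := isClosed_le hgc continuous_const
      rw [← closure_Ico hb0.ne]
      exact fun t ht => closure_minimal (fun s hs => (hlt s hs).le) hcl ht
    have hbI : b ∈ I := hI ⟨by linarith, hbc.2⟩
    have hxu : ∀ t ∈ Set.Icc 0 b, ‖x t - Y t‖ ≤ δ := fun t ht => by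
      rw [← hux t ⟨ht.1, ht.2.trans hbc.2⟩]; exact hle t ht
    refine ⟨b, hbI, hb0, hbc.2.trans hcL, hx.1.lipschitzOnWith_of_near hr hY hδ hδρ hM hbI hb0.le
      (hbc.2.trans hcL) hxu, ?_⟩
    rw [← hux b hbc]
    exact le_antisymm (hle b ⟨hb0.le, le_rfl⟩) hbδ
  -- If `x` never gets as far as `δ`, then `I` ends at some `b ≤ L`. Maximality is contradicted by
  -- Peano continuation when `b ∈ I`, and by the Lipschitz extension to `b` when `b ∉ I`.
  · exfalso
    push Not at hfar
    have hLI : L ∉ I := fun hLI => hbad ⟨hx.1.Icc_subset_of_mem hr hLI, fun t ht =>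
      hfar t (hx.1.Icc_subset_of_mem hr hLI ⟨by linarith [ht.1], ht.2⟩) ht.1 ht.2⟩
    obtain ⟨t₀, ht₀, ht₀pos⟩ := hx.1.exists_pos
    have hub : ∀ t ∈ I, t ≤ L := by
      intro t ht
      by_contra hcon
      by_cases h0 : -r ≤ L
      · exact hLI (hx.1.Icc_subset_of_mem hr ht ⟨h0, (not_le.mp hcon).le⟩)
      · refine hbad ⟨fun s hs => absurd (hs.1.trans hs.2) h0, fun s hs => ?_⟩
        exact absurd (hs.1.trans hs.2) (by linarith)
    have hbdd : BddAbove I := ⟨L, hub⟩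
    set b := sSup I with hb
    have hb0 : 0 < b := ht₀pos.trans_le (le_csSup hbdd ht₀)
    have hbL : b ≤ L := csSup_le ⟨t₀, ht₀⟩ hub
    have hIco : Set.Ico (-r) b ⊆ I := by
      intro t ht
      obtain ⟨s, hs, hts⟩ := exists_lt_of_lt_csSup ⟨t₀, ht₀⟩ ht.2
      exact hx.1.Icc_subset_of_mem hr hs ⟨ht.1, hts.le⟩
    by_cases hbI : b ∈ I
    · have hIeq : I = Set.Icc (-r) b := Set.Subset.antisymm
        (fun t ht => ⟨hx.1.subset_Ici ht, le_csSup hbdd ht⟩) (hx.1.Icc_subset_of_mem hr hbI)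
      have hx1 := hx.1
      rw [hIeq] at hx1
      obtain ⟨c, hcb, x', hx', hxx'⟩ := hx1.exists_continuation hr hG
      have := hx.2 _ x' hx' (hIeq ▸ Set.Icc_subset_Icc_right hcb.le) (hIeq ▸ hxx')
      have hc : c ∈ I := this ▸ ⟨by linarith, le_rfl⟩
      linarith [le_csSup hbdd hc]
    · have hIeq : I = Set.Ico (-r) b := Set.Subset.antisymm
        (fun t ht => ⟨hx.1.subset_Ici ht, (le_csSup hbdd ht).lt_of_ne fun h => hbI (by rwa [hb, ← h])⟩) hIco
      obtain ⟨x', hx', hxx'⟩ := hx.1.exists_extension_right hr hG hb0 hIco (M := M) fun c hc => by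
        have hcI : c ∈ I := hIco ⟨by linarith [hc.1], hc.2⟩
        refine hx.1.lipschitzOnWith_of_near hr hY hδ hδρ hM hcI hc.1 (hub c hcI) fun t ht => ?_
        have htI : t ∈ I := hIco ⟨by linarith [ht.1], ht.2.trans_lt hc.2⟩
        exact (hfar t htI ht.1 (hub t htI)).le
      have := hx.2 _ x' hx' (hIeq ▸ Set.Ico_subset_Icc_self) (hIeq ▸ hxx')
      exact hbI (this ▸ ⟨by linarith, le_rfl⟩)

end Continuation

/-! ### The averaging theorem for globally continuous fields. -/

section Averaging

variable {r : ℝ} {E : Type*} [NormedAddCommGroup E] [NormedSpace ℝ E] [FiniteDimensional ℝ E]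

theorem IsTimeAverage.averaging {f : ℝ → Hist r E → E} {F : Hist r E → E} (hr : 0 ≤ r)
    (hf : Continuous (Function.uncurry f)) (h : UniformlyContinuousInState f)
    (hbt : BoundedInTime f) (hF : IsTimeAverage f F) {φ : Hist r E}
    (huniq : ∀ (I₁ I₂ : Set ℝ) (x₁ x₂ : ℝ → E), IsSolution (fun _ => F) φ I₁ x₁ →
      IsSolution (fun _ => F) φ I₂ x₂ → Set.EqOn x₁ x₂ (I₁ ∩ I₂))
    {J : Set ℝ} {y : ℝ → E} (hy : IsSolution (fun _ => F) φ J y) {L : ℝ} (hL : L ∈ J)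
    (hL0 : 0 < L) {δ : ℝ} (hδ : 0 < δ) :
    ∃ ε₀ > (0 : ℝ), ∀ ε ∈ Set.Ioc 0 ε₀, ∀ (I : Set ℝ) (x : ℝ → E),
      IsMaximalSolution (fun t => f (t / ε)) φ I x →
        Set.Icc (-r) L ⊆ I ∧ ∀ t ∈ Set.Icc 0 L, ‖x t - y t‖ < δ := by
  have : CompleteSpace E := FiniteDimensional.complete ℝ E
  have hJ := hy.Icc_subset_of_mem hr hL
  obtain ⟨Y, hYy⟩ := exists_continuousMap_stopped (show -r ≤ L by linarith)
    (hy.continuousOn.mono hJ)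
  replace hYy : ∀ t ∈ Set.Icc (-r) L, Y t = y t := fun t ht => by
    rw [hYy, min_eq_left ht.2, max_eq_right ht.1]
  have hYφ : ∀ θ : Set.Icc (-r) (0 : ℝ), Y θ = φ θ := fun θ => by
    rw [hYy θ ⟨θ.2.1, θ.2.2.trans hL0.le⟩, hy.initial]
  have hhist : Continuous fun s => hist r Y s :=
    (continuous_hist r).comp (continuous_const.prodMk continuous_id)
  obtain ⟨ρ, hρ, M, hM⟩ := hbt.exists_bound_near_compact h
    ((isCompact_Icc (a := 0) (b := L)).image hhist)
  -- Leaving the `δ`-tube implies leaving the `d`-tube, and `d < ρ` keeps the bound `M` valid up to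
  -- the exit.
  set d := min δ (ρ / 2) with hd
  have hd0 : 0 < d := by positivity
  have hdδ : d ≤ δ := min_le_left _ _
  have hdρ : d < ρ := (min_le_right _ _).trans_lt (half_lt_self hρ)
  by_contra hcon
  push Not at hcon
  have hscale : ∀ e : ℝ, Continuous (Function.uncurry fun t => f (t / e)) := fun e =>
    hf.comp ((continuous_fst.div_const e).prodMk continuous_snd)
  have hseq : ∀ n : ℕ, ∃ e : ℝ, 0 < e ∧ e ≤ 1 / ((n : ℝ) + 1) ∧ ∃ (v : C(ℝ, E)) (b : ℝ),
      (LipschitzWith M v ∧ v 0 = 0) ∧ b ∈ Set.Icc 0 L ∧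
      (∀ θ : Set.Icc (-r) (0 : ℝ), (extendHist hr φ + v) θ = φ θ) ∧
      ‖(extendHist hr φ + v) b - Y b‖ = d ∧ ∀ t ∈ Set.Icc 0 b, (extendHist hr φ + v) t =
        (extendHist hr φ + v) 0 + ∫ s in (0 : ℝ)..t, f (s / e) (hist r (extendHist hr φ + v) s) := by
    intro n
    obtain ⟨e, he, I, x, hx, hbad⟩ := hcon (1 / ((n : ℝ) + 1)) Nat.one_div_pos_of_nat
    refine ⟨e, he.1, he.2, ?_⟩
    obtain ⟨b, hbI, hb0, hbL, hLip, hbd⟩ := hx.exists_exit_time hr (hscale e) hYφ (L := L) hd0 hdρ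
      (M := M) (fun s hs p hp t ht => hM _ (Set.mem_image_of_mem _ hs) p hp _
        (div_nonneg ht he.1.le)) (fun hgood => by
          obtain ⟨t, ht, hle⟩ := hbad hgood.1
          have := hgood.2 t ht
          rw [hYy t ⟨by linarith [ht.1], ht.2⟩] at this
          linarith)
    obtain ⟨v, hv, hvx⟩ := hx.1.exists_stopped hr hb0.le hLip
    refine ⟨v, b, hv, ⟨hb0.le, hbL⟩, fun θ => ?_, ?_, hx.1.integral_eq (hscale e) hr hbI hvx⟩
    · rw [hvx θ ⟨θ.2.1, θ.2.2.trans hb0.le⟩, hx.1.initial]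
    · rw [hvx b ⟨by linarith, le_rfl⟩]
      exact hbd
  choose e he hen v b hv hb hini hbd hint using hseq
  obtain ⟨w, σ, hσ, hw⟩ := exists_subseq_tendsto_of_lipschitzWith hv
  obtain ⟨c, hc, τ, hτ, hcb⟩ := isCompact_Icc.tendsto_subseq fun n => hb (σ n)
  have hw' : Tendsto (fun n => extendHist hr φ + v (σ (τ n))) atTop (𝓝 (extendHist hr φ + w)) :=
    (hw.comp hτ.tendsto_atTop).const_add _
  set u := extendHist hr φ + w with hu
  have he0 : Tendsto (fun n => e (σ (τ n))) atTop (𝓝 0) :=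
    (squeeze_zero (fun n => (he n).le) hen tendsto_one_div_add_atTop_nhds_zero_nat).comp
      (hσ.comp hτ).tendsto_atTop
  have heval : ∀ t, Tendsto (fun n => (extendHist hr φ + v (σ (τ n))) t) atTop (𝓝 (u t)) := fun t =>
    ((continuous_eval_const (F := C(ℝ, E)) t).tendsto u).comp hw'
  have hud : ‖u c - Y c‖ = d := by
    have h1 : Tendsto (fun n => ‖(extendHist hr φ + v (σ (τ n))) (b (σ (τ n))) - Y (b (σ (τ n)))‖)
        atTop (𝓝 ‖u c - Y c‖) := by
      have hev : Continuous fun p : C(ℝ, E) × ℝ => p.1 p.2 := continuous_eval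
      exact (((hev.tendsto (u, c)).comp (hw'.prodMk_nhds hcb)).sub
        ((Y.continuous.tendsto c).comp hcb)).norm
    exact tendsto_nhds_unique h1 (tendsto_const_nhds.congr fun n => (hbd _).symm)
  have huφ : ∀ θ : Set.Icc (-r) (0 : ℝ), u θ = φ θ := fun θ =>
    tendsto_nhds_unique (heval θ) (tendsto_const_nhds.congr fun n => (hini _ θ).symm)
  have hc0 : 0 < c := by
    refine hc.1.lt_of_ne ?_
    rintro rfl
    have := huφ ⟨0, by linarith, le_rfl⟩
    rw [← hYφ] at this
    simp only at this
    rw [this, sub_self, norm_zero] at hud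
    linarith
  have hFc : Continuous (Function.uncurry fun _ : ℝ => F) :=
    (hF.continuous hf h).comp continuous_snd
  -- The exit times converge to `c` but may lie below it, so the limit equation is first obtained
  -- for `t < c`; continuity adds the end point.
  have hIco : ∀ t ∈ Set.Ico 0 c, u t = u 0 + ∫ s in (0 : ℝ)..t, F (hist r u s) := by
    intro t ht
    refine tendsto_nhds_unique_of_eventuallyEq (heval t) ((heval 0).add
      (hF.tendsto_integral_hist hf h (fun n => he _) he0 hw' ht.1)) ?_
    filter_upwards [hcb.eventually (lt_mem_nhds ht.2)] with n hn
    exact hint _ t ⟨ht.1, hn.le⟩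
  have hIcc : Set.EqOn u (fun t => u 0 + ∫ s in (0 : ℝ)..t, F (hist r u s)) (Set.Icc 0 c) := by
    rw [← closure_Ico hc0.ne]
    refine Set.EqOn.closure hIco u.continuous ?_
    exact continuous_const.add (intervalIntegral.continuous_primitive
      (fun a c => (continuous_comp_hist hFc u).intervalIntegrable a c) 0)
  have hsol : IsSolution (fun _ => F) φ (Set.Icc (-r) c) u :=
    isSolution_of_integral_eq hFc hr hc0 huφ hIcc
  have hcmem : c ∈ Set.Icc (-r) L := ⟨by linarith, hc.2⟩
  have := huniq _ _ _ _ hsol hy ⟨⟨by linarith, le_rfl⟩, hJ hcmem⟩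
  rw [this, hYy c hcmem, sub_self, norm_zero] at hud
  linarith

end Averaging

end RFDE

theorem corollary2p9 {E : Type*} [NormedAddCommGroup E] [NormedSpace ℝ E]
    [FiniteDimensional ℝ E] (r : ℝ) (hr : 0 ≤ r) (f : ℝ → RFDE.Hist r E → E)
    (hf : RFDE.IsContinuousField f)
    (h5 : RFDE.QuasiBounded f)
    (hper : RFDE.PeriodicInTime f ∨ RFDE.SumOfPeriodicInTime f ∨
      (RFDE.AlmostPeriodicInTime f ∧ RFDE.UniformlyContinuousInState f)) :
    ∃ F : RFDE.Hist r E → E, RFDE.IsTimeAverage f F ∧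
      ∀ φ : RFDE.Hist r E, RFDE.HasUniqueSolution (fun _ => F) φ →
        ∀ (J : Set ℝ) (y : ℝ → E), RFDE.IsMaximalSolution (fun _ => F) φ J y →
          ∀ L ∈ J, 0 < L → ∀ δ > (0 : ℝ), ∃ ε₀ > (0 : ℝ), ∀ ε ∈ Set.Ioc 0 ε₀,
            ∀ (I : Set ℝ) (x : ℝ → E),
              RFDE.IsMaximalSolution (fun t => f (t / ε)) φ I x →
                Set.Icc (-r) L ⊆ I ∧ ∀ t ∈ Set.Icc 0 L, ‖x t - y t‖ < δ := by
  have : CompleteSpace E := FiniteDimensional.complete ℝ E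
  obtain ⟨F, hF, h1, hbt⟩ : ∃ F, RFDE.IsTimeAverage f F ∧ RFDE.UniformlyContinuousInState f ∧
      RFDE.BoundedInTime f := by
    rcases hper with hp | ⟨n, p, hp, hsum⟩ | ⟨hap, h1⟩
    · obtain ⟨F, hF⟩ := hp.almostPeriodicInTime.exists_isTimeAverage hf
      exact ⟨F, hF, hp.uniformlyContinuousInState hf, hp.almostPeriodicInTime.boundedInTime hf⟩
    · choose P hP using fun i => (hp i).2.almostPeriodicInTime.exists_isTimeAverage (hp i).1
      exact ⟨_, RFDE.IsTimeAverage.of_eq_sum (fun i => (hp i).1) hP hsum,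
        .of_eq_sum (fun i => (hp i).2.uniformlyContinuousInState (hp i).1) hsum,
        .of_eq_sum (fun i => (hp i).2.almostPeriodicInTime.boundedInTime (hp i).1) hsum⟩
    · obtain ⟨F, hF⟩ := hap.exists_isTimeAverage hf
      exact ⟨F, hF, h1, hap.boundedInTime hf⟩
  refine ⟨F, hF, fun φ huniq J y hy L hL hL0 δ hδ => ?_⟩
  -- Freezing the field at time `0` for negative times makes it continuous on the whole space
  -- without changing any solution.
  let g : ℝ → RFDE.Hist r E → E := fun t => f (max t 0)
  have hgf : ∀ t, 0 ≤ t → g t = f t := fun t ht => by simp only [g, max_eq_left ht]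
  have hg : Continuous (Function.uncurry g) :=
    ContinuousOn.comp_continuous (g := Function.uncurry f) (f := fun p : ℝ × RFDE.Hist r E => (max p.1 0, p.2)) hf
      (by fun_prop) fun p => ⟨le_max_right p.1 0, trivial⟩
  obtain ⟨ε₀, hε₀, H⟩ := (hF.congr (g := g) fun t ht x => by rw [hgf t ht]).averaging hr hg
    (fun x η hη => by
      obtain ⟨ρ, hρ, hx⟩ := h1 x η hη
      exact ⟨ρ, hρ, fun x' hx' t ht => by rw [hgf t ht]; exact hx x' hx' t ht⟩)
    (fun x => by
      obtain ⟨M, hM⟩ := hbt x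
      exact ⟨M, fun t ht => by rw [hgf t ht]; exact hM t ht⟩) huniq.2 hy.1 hL hL0 hδ
  exact ⟨ε₀, hε₀, fun ε hε I x hx => H ε hε I x
    (hx.congr_field fun t ht => hgf _ (div_nonneg ht hε.1.le))⟩
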